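/- Let $\mathbb{T}^3=\mathbb{R}^3/\mathbb{Z}^3$, $0<T<\infty$, $1<\gamma<2$, and let $\alpha,\beta\in(0,1]$ satisfy $$\gamma\alpha+\beta>1,\qquad \alpha+2\beta>1 .$$ For $0<\theta\le 1$ let $C^{\theta}(\mathbb{T}^3\times(0,T))$ be the space of functions that are Hölder continuous in $(x,t)$ jointly with exponent $\theta$ on $\mathbb{T}^3\times(0,T)$ (Lipschitz continuous if $\theta=1$). Let $\rho:\mathbb{T}^3\times(0,T)\to\mathbb{R}$ and $u:\mathbb{T}^3\times(0,T)\to\mathbb{R}^3$ satisfy $\rho\ge 0$ (vacuum regions $\{\rho=0\}$ are allowed) and $$\rho\in C^{\alpha}(\mathbb{T}^3\times(0,T)),\qquad \rho u\in C^{\alpha}(\mathbb{T}^3\times(0,T)),\qquad u\in C^{\beta}(\mathbb{T}^3\times(0,T)),$$ and let $(\rho,u)$ solve the isentropic compressible Euler system $$\partial_t\rho+\operatorname{div}(\rho u)=0,\qquad \partial_t(\rho u)+\operatorname{div}(\rho u\otimes u)+\nabla p(\rho)=0,\qquad p(\rho)=\rho^{\gamma},$$ in the sense of distributions on $\mathbb{T}^3\times(0,T)$.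 Put $P(r)=r\int_1^r p(s)s^{-2}\,ds$. Then the energy is conserved: locally, i.e. $$\partial_t\left(\tfrac12\rho|u|^2+P(\rho)\right)+\operatorname{div}\left[\left(\tfrac12\rho|u|^2+p(\rho)+P(\rho)\right)u\right]=0$$ in the sense of distributions on $\mathbb{T}^3\times(0,T)$, and therefore also globally, i.e. $\int_{\mathbb{T}^3}\left(\tfrac12\rho|u|^2+P(\rho)\right)(x,t)\,dx$ is the same for all $t\in(0,T)$. -/

import Mathlib

open MeasureTheory Set
open scoped NNReal ContDiff

namespace CompressibleEuler

/-- Space-time points `(x, t)`, where `x` lies in the flat torus `𝕋³ = ℝ³ / ℤ³`. -/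
abbrev SpaceTime : Type := UnitAddTorus (Fin 3) × ℝ

/-- The velocity space `ℝ³` with its Euclidean norm. -/
abbrev Vel : Type := EuclideanSpace ℝ (Fin 3)

/-- The cylinder `𝕋³ × (0, T)`. -/
def cylinder (T : ℝ) : Set SpaceTime := univ ×ˢ Ioo 0 T

/-- `f ∈ C^α(𝕋³ × (0, T))`: joint Hölder continuity in space and time with exponent `α`
(Lipschitz continuity when `α = 1`).  The domain is bounded, so that such an `f` is bounded there. -/
def MemHolderSpace {E : Type*} [PseudoEMetricSpace E] (T : ℝ) (α : ℝ≥0) (f : SpaceTime → E) :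
    Prop :=
  ∃ C : ℝ≥0, HolderOnWith C α f (cylinder T)

/-- The partial derivative `∂_j φ` in the `j`-th space direction. -/
noncomputable def spaceDeriv (j : Fin 3) (φ : SpaceTime → ℝ) (z : SpaceTime) : ℝ :=
  deriv (fun s : ℝ => φ (z.1 + Pi.single j (s : UnitAddCircle), z.2)) 0

/-- The partial derivative `∂_t φ`. -/
noncomputable def timeDeriv (φ : SpaceTime → ℝ) (z : SpaceTime) : ℝ :=
  deriv (fun s : ℝ => φ (z.1, s)) z.2

/-- `φ ∈ C_c^∞(𝕋³ × (0, T))`; smoothness is that of the periodic lift of `φ` to `ℝ³ × ℝ`. -/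
structure IsTestFunction (T : ℝ) (φ : SpaceTime → ℝ) : Prop where
  smooth : ContDiff ℝ ∞ fun y : (Fin 3 → ℝ) × ℝ => φ (fun i => (y.1 i : UnitAddCircle), y.2)
  hasCompactSupport : HasCompactSupport φ
  tsupport_subset : tsupport φ ⊆ cylinder T

/-- `∂_t e + div F = 0` in the sense of distributions on `𝕋³ × (0, T)`, for a locally integrable
density `e` and a locally integrable flux `F`. -/
structure IsConservationLaw (T : ℝ) (e : SpaceTime → ℝ) (F : SpaceTime → Vel) : Prop where
  density_locallyIntegrable : LocallyIntegrableOn e (cylinder T)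
  flux_locallyIntegrable : LocallyIntegrableOn F (cylinder T)
  weak_eq : ∀ φ : SpaceTime → ℝ, IsTestFunction T φ →
    ∫ z in cylinder T, (e z * timeDeriv φ z + ∑ j, F z j * spaceDeriv j φ z) = 0

/-- `(ρ, u)` solves the isentropic compressible Euler system with pressure law `p` in the sense of
distributions on `𝕋³ × (0, T)`:
`∂_t ρ + div (ρ u) = 0` and `∂_t (ρ u) + div (ρ u ⊗ u) + ∇ p(ρ) = 0`,
the second equation being read component by component. -/
structure IsDistributionalSolution (T : ℝ) (p : ℝ → ℝ) (ρ : SpaceTime → ℝ) (u : SpaceTime → Vel) :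
    Prop where
  mass : IsConservationLaw T ρ fun z => ρ z • u z
  momentum : ∀ i : Fin 3, IsConservationLaw T (fun z => ρ z * u z i) fun z =>
    (ρ z * u z i) • u z + p (ρ z) • EuclideanSpace.single i (1 : ℝ)

/-- The pressure potential `P(r) = r ∫₁^r p(s) / s² ds`. -/
noncomputable def pressurePotential (p : ℝ → ℝ) (r : ℝ) : ℝ :=
  r * ∫ s in (1 : ℝ)..r, p s / s ^ 2

/-- The energy density `½ ρ |u|² + P(ρ)`. -/
noncomputable def energyDensity (p : ℝ → ℝ) (ρ : SpaceTime → ℝ) (u : SpaceTime → Vel)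
    (z : SpaceTime) : ℝ :=
  1 / 2 * ρ z * ‖u z‖ ^ 2 + pressurePotential p (ρ z)

/-- The energy flux `(½ ρ |u|² + p(ρ) + P(ρ)) u`. -/
noncomputable def energyFlux (p : ℝ → ℝ) (ρ : SpaceTime → ℝ) (u : SpaceTime → Vel)
    (z : SpaceTime) : Vel :=
  (1 / 2 * ρ z * ‖u z‖ ^ 2 + p (ρ z) + pressurePotential p (ρ z)) • u z

end CompressibleEuler

/-!
The proof is the commutator argument of Constantin, E and Titi, adapted to vacuum. A bar denotes
mollification in space and time at scale `ε`, `m = ρ u` is the mass flux, and `σ = ρ̄ + δ` is a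
strictly positive substitute for the mollified density. The mollified momentum equation is tested
with `φ ū`, and the mollified mass equation with `φ |ū|² / 2` and with `φ σ ^ (γ - 1)`, which is
smooth because `σ > 0`. The outcome, `integral_energyPairing_eq`, is the energy balance for
`(m̄, ū, σ)` up to three residuals, each tested against a derivative:

* `(m u)‾ - m̄ ū`, of order `ε ^ (α + β)`, against `∇ (φ ū)`, of order `ε ^ (β - 1)`. The product
  vanishes because `α + 2 β > 1`. Time derivatives of `ρ u` give a residual of the same form.
* `(ρ ^ γ)‾ - σ ^ γ` against `∇ (φ ū)`. Since `r ^ γ` is of class `C^{1, γ - 1}` down to `r = 0`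
  and the linear Taylor term averages out, this residual is of order `ε ^ (γ α) + δ`
  (`HolderState.abs_pressure_commutator_le`), and `γ α + β > 1` suffices.
* `m̄ - σ ū` against `∇ (φ σ ^ (γ - 1))`, where a factor `σ ^ (γ - 2)` appears that is singular near
  vacuum. As `ρ ≥ 0`, the commutator `m̄ - ρ̄ ū` is bounded not only by `ε ^ (α + β)` but also by
  `ε ^ β ρ̄` (`HolderState.abs_mass_commutator_le`), and
  `min (σ, ε ^ α) σ ^ (γ - 2) ≤ ε ^ (α (γ - 1))`. With `|∇ σ| ≲ ε ^ (α - 1)` the product is again of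
  order `ε ^ (γ α + β - 1)`. The contribution of the shift is controlled by `δ ^ (γ - 1) = ε`.

Letting `ε → 0` gives the local balance (`HolderState.integral_energyPairing_eq_zero`) with the
pressure potential `r ^ γ / (γ - 1)`; the actual one differs from it by a multiple of `r`, for which
the balance is the mass equation. Testing the local balance with functions of time alone shows that
the total energy has zero weak derivative, hence is constant (`IsConservationLaw.integral_slice_eq`).

Time is treated on a par with the space directions: the index type `Option (Fin 3)` labels the
coordinates of space-time and a conservation law is a divergence-free condition on a four-vector.
-/

namespace CompressibleEuler

/-! ### Differential calculus on `𝕋³ × ℝ` through the universal cover -/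

/-- The universal cover `ℝ³ × ℝ` of space-time. -/
abbrev Cover : Type := (Fin 3 → ℝ) × ℝ

/-- The covering map `ℝ³ × ℝ → 𝕋³ × ℝ`. -/
def proj (y : Cover) : SpaceTime := (fun i => (y.1 i : UnitAddCircle), y.2)

/-- The coordinate directions of space-time: `none` is time and `some j` is the `j`-th space
direction, so that a conservation law is `∑ k, ∂_k F_k = 0` with the density as the component
`none` of the flux. -/
def axis : Option (Fin 3) → Cover
  | none => (0, 1)
  | some j => (Pi.single j 1, 0)

/-- The derivative of `ψ` at `z` in the direction `v`. -/
noncomputable def dirDeriv (v : Cover) (ψ : SpaceTime → ℝ) (z : SpaceTime) : ℝ :=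
  deriv (fun s : ℝ => ψ (z + proj (s • v))) 0

/-- Smoothness of a function on space-time, read on the universal cover as in `IsTestFunction`. -/
def Smooth (ψ : SpaceTime → ℝ) : Prop := ContDiff ℝ ∞ fun y => ψ (proj y)

instance : (volume : Measure SpaceTime).IsAddLeftInvariant :=
  haveI : (volume : Measure (UnitAddTorus (Fin 3))).IsAddLeftInvariant :=
    inferInstanceAs (volume : Measure (Fin 3 → UnitAddCircle)).IsAddLeftInvariant
  inferInstanceAs
    ((volume : Measure (UnitAddTorus (Fin 3))).prod (volume : Measure ℝ)).IsAddLeftInvariant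

instance : (volume : Measure Cover).IsAddHaarMeasure :=
  inferInstanceAs
    ((volume : Measure (Fin 3 → ℝ)).prod (volume : Measure ℝ)).IsAddHaarMeasure

lemma proj_add (x y : Cover) : proj (x + y) = proj x + proj y := by
  ext <;> simp [proj]

lemma proj_neg (x : Cover) : proj (-x) = -proj x := by
  ext <;> simp [proj]

lemma proj_sub (x y : Cover) : proj (x - y) = proj x - proj y := by
  rw [sub_eq_add_neg, proj_add, proj_neg, sub_eq_add_neg]

lemma proj_zero : proj 0 = 0 := by
  ext <;> simp [proj]

lemma isOpenQuotientMap_proj : IsOpenQuotientMap proj :=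
  (IsOpenQuotientMap.piMap fun _ : Fin 3 =>
    QuotientAddGroup.isOpenQuotientMap_mk (N := AddSubgroup.zmultiples (1 : ℝ))).prodMap
    IsOpenQuotientMap.id

lemma continuous_proj : Continuous proj := isOpenQuotientMap_proj.continuous

lemma norm_proj_le (y : Cover) : ‖proj y‖ ≤ ‖y‖ := by
  refine norm_prod_le_iff.2 ⟨?_, norm_snd_le y⟩
  refine (pi_norm_le_iff_of_nonneg (norm_nonneg y)).2 fun i => ?_
  exact (QuotientAddGroup.norm_mk_le_norm (S := AddSubgroup.zmultiples (1 : ℝ))).trans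
    ((norm_le_pi_norm y.1 i).trans (norm_fst_le y))

lemma dist_sub_proj_le (z : SpaceTime) (y : Cover) : dist (z - proj y) z ≤ ‖y‖ := by
  rw [dist_eq_norm, sub_sub_cancel_left, norm_neg]
  exact norm_proj_le y

namespace Smooth

variable {ψ χ : SpaceTime → ℝ}

lemma continuous (h : Smooth ψ) : Continuous ψ :=
  isOpenQuotientMap_proj.isQuotientMap.continuous_iff.2 (ContDiff.continuous h)

lemma const (c : ℝ) : Smooth fun _ => c := contDiff_const

lemma add (h : Smooth ψ) (h' : Smooth χ) : Smooth fun z => ψ z + χ z := ContDiff.add h h'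

lemma mul (h : Smooth ψ) (h' : Smooth χ) : Smooth fun z => ψ z * χ z := ContDiff.mul h h'

lemma rpow (h : Smooth ψ) (hpos : ∀ z, 0 < ψ z) (p : ℝ) : Smooth fun z => ψ z ^ p :=
  ContDiff.rpow_const_of_ne h fun _ => (hpos _).ne'

lemma translate (h : Smooth ψ) (w : SpaceTime) : Smooth fun z => ψ (z + w) := by
  obtain ⟨y, rfl⟩ := isOpenQuotientMap_proj.surjective w
  have : (fun x => ψ (proj x + proj y)) = (fun x => ψ (proj x)) ∘ fun x => x + y := by
    ext x; simp [proj_add]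
  show ContDiff ℝ ∞ fun x => ψ (proj x + proj y)
  rw [this]
  exact ContDiff.comp (g := fun x => ψ (proj x)) h (contDiff_id.add contDiff_const)

lemma hasDerivAt (h : Smooth ψ) (v : Cover) (z : SpaceTime) :
    HasDerivAt (fun s : ℝ => ψ (z + proj (s • v))) (dirDeriv v ψ z) 0 := by
  obtain ⟨y, rfl⟩ := isOpenQuotientMap_proj.surjective z
  have h1 : (fun s : ℝ => ψ (proj y + proj (s • v))) = fun s => ψ (proj (y + s • v)) := by
    ext s; rw [proj_add]
  have h2 : DifferentiableAt ℝ (fun s : ℝ => ψ (proj y + proj (s • v))) 0 := by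
    rw [h1]
    exact (ContDiff.comp (g := fun x => ψ (proj x)) h
      (contDiff_const.add (contDiff_id.smul contDiff_const))).differentiable (by simp) 0
  exact h2.hasDerivAt

lemma hasDerivAt_line (h : Smooth ψ) (v : Cover) (z : SpaceTime) (s : ℝ) :
    HasDerivAt (fun s : ℝ => ψ (z + proj (s • v))) (dirDeriv v ψ (z + proj (s • v))) s := by
  have h1 := h.hasDerivAt v (z + proj (s • v))
  rw [← sub_self s] at h1
  have h2 := h1.comp_sub_const s s
  refine h2.congr_of_eventuallyEq (Filter.Eventually.of_forall fun r => ?_)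
  simp only [add_assoc, ← proj_add, ← add_smul, add_sub_cancel]

lemma dirDeriv_proj (h : Smooth ψ) (v y : Cover) :
    dirDeriv v ψ (proj y) = fderiv ℝ (fun x => ψ (proj x)) y v := by
  have h1 : (fun s : ℝ => ψ (proj y + proj (s • v))) = fun s => ψ (proj (y + s • v)) := by
    ext s; rw [proj_add]
  have h2 := (ContDiff.differentiable h (by simp) y).hasFDerivAt.hasLineDerivAt v
  exact (h1 ▸ h2.deriv : deriv (fun s : ℝ => ψ (proj y + proj (s • v))) 0 = _)

lemma continuous_dirDeriv (h : Smooth ψ) (v : Cover) : Continuous (dirDeriv v ψ) := by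
  refine isOpenQuotientMap_proj.isQuotientMap.continuous_iff.2 ?_
  have : dirDeriv v ψ ∘ proj = fun y => fderiv ℝ (fun x => ψ (proj x)) y v :=
    funext fun y => h.dirDeriv_proj v y
  rw [this]
  exact (ContDiff.continuous_fderiv h (by simp)).clm_apply continuous_const

lemma dirDeriv_mul (h : Smooth ψ) (h' : Smooth χ) (v : Cover) (z : SpaceTime) :
    dirDeriv v (fun z => ψ z * χ z) z = dirDeriv v ψ z * χ z + ψ z * dirDeriv v χ z := by
  have : dirDeriv v (fun z => ψ z * χ z) z = _ :=
    ((h.hasDerivAt v z).mul (h'.hasDerivAt v z)).deriv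
  simpa [proj_zero] using this

lemma dirDeriv_add_const (ψ : SpaceTime → ℝ) (c : ℝ) (v : Cover) (z : SpaceTime) :
    dirDeriv v (fun z => ψ z + c) z = dirDeriv v ψ z := by
  simp [dirDeriv]

lemma dirDeriv_rpow (h : Smooth ψ) (hpos : ∀ z, 0 < ψ z) (p : ℝ) (v : Cover) (z : SpaceTime) :
    dirDeriv v (fun z => ψ z ^ p) z = dirDeriv v ψ z * p * ψ z ^ (p - 1) := by
  have : dirDeriv v (fun z => ψ z ^ p) z = _ :=
    ((h.hasDerivAt v z).rpow_const (p := p) (Or.inl (hpos _).ne')).deriv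
  simpa [proj_zero] using this

end Smooth

lemma dirDeriv_translate (ψ : SpaceTime → ℝ) (v : Cover) (w z : SpaceTime) :
    dirDeriv v (fun z => ψ (z + w)) z = dirDeriv v ψ (z + w) := by
  simp only [dirDeriv, add_right_comm]

lemma dirDeriv_const (c : ℝ) (v : Cover) (z : SpaceTime) : dirDeriv v (fun _ => c) z = 0 := by
  simp [dirDeriv]

lemma dirDeriv_eq_zero {ψ : SpaceTime → ℝ} {z : SpaceTime} (hz : z ∉ tsupport ψ) (v : Cover) :
    dirDeriv v ψ z = 0 := by
  have h1 : Filter.Tendsto (fun s : ℝ => z + proj (s • v)) (nhds 0) (nhds z) := by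
    have : Continuous fun s : ℝ => z + proj (s • v) :=
      continuous_const.add (continuous_proj.comp (by fun_prop))
    simpa [proj_zero] using this.tendsto 0
  have h2 : (fun s : ℝ => ψ (z + proj (s • v))) =ᶠ[nhds 0] fun _ => 0 :=
    h1.eventually (notMem_tsupport_iff_eventuallyEq.1 hz)
  rw [dirDeriv, h2.deriv_eq, deriv_const]

lemma tsupport_dirDeriv_subset (ψ : SpaceTime → ℝ) (v : Cover) :
    tsupport (dirDeriv v ψ) ⊆ tsupport ψ :=
  closure_minimal (fun _ hz => by_contra fun h => hz (dirDeriv_eq_zero h v)) (isClosed_tsupport ψ)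

lemma dirDeriv_axis_none (φ : SpaceTime → ℝ) (z : SpaceTime) :
    dirDeriv (axis none) φ z = timeDeriv φ z := by
  have h : (fun s : ℝ => φ (z + proj (s • axis none))) = fun s => φ (z.1, z.2 + s) := by
    ext s
    congr 1
    ext <;> simp [proj, axis]
  rw [dirDeriv, h, timeDeriv]
  simpa using deriv_comp_const_add (f := fun s : ℝ => φ (z.1, s)) z.2 0

lemma dirDeriv_axis_some (φ : SpaceTime → ℝ) (j : Fin 3) (z : SpaceTime) :
    dirDeriv (axis (some j)) φ z = spaceDeriv j φ z := by
  rw [dirDeriv, spaceDeriv]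
  congr 1
  ext s
  congr 1
  refine Prod.ext (funext fun i => ?_) ?_
  · by_cases hij : i = j
    · subst hij; simp [proj, axis]
    · simp [proj, axis, Pi.single_eq_of_ne hij]
  · simp [proj, axis]

/-- The integral over space-time of a derivative of a compactly supported smooth function
vanishes: the integral of a function is invariant under translation. -/
lemma integral_dirDeriv_eq_zero {ψ : SpaceTime → ℝ} (h : Smooth ψ) (hc : HasCompactSupport ψ)
    (v : Cover) : ∫ z, dirDeriv v ψ z = 0 := by
  have hcd : HasCompactSupport (dirDeriv v ψ) :=
    hc.of_isClosed_subset (isClosed_tsupport _) (tsupport_dirDeriv_subset ψ v)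
  obtain ⟨C, hC⟩ := (h.continuous_dirDeriv v).bounded_above_of_compact_support hcd
  have hline : Continuous fun s : ℝ => proj (s • v) := continuous_proj.comp (by fun_prop)
  -- all translates by `proj (s • v)`, `|s| ≤ 1`, are supported in one compact set
  let K : Set SpaceTime := 
    (fun w : SpaceTime × ℝ => w.1 - proj (w.2 • v)) '' (tsupport ψ ×ˢ Icc (-1) 1)
  have hK : IsCompact K := 
    (hc.isCompact.prod isCompact_Icc).image (continuous_fst.sub (hline.comp continuous_snd))
  have hcont : ∀ s : ℝ, Continuous fun z => ψ (z + proj (s • v)) := fun s =>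
    (h.translate _).continuous
  have hderiv := (hasDerivAt_integral_of_dominated_loc_of_deriv_le (μ := volume)
    (F := fun s z => ψ (z + proj (s • v))) (F' := fun s z => dirDeriv v ψ (z + proj (s • v)))
    (x₀ := (0 : ℝ)) (s := Icc (-1) 1) (bound := K.indicator fun _ => C)
    (Icc_mem_nhds (by norm_num) (by norm_num))
    (Filter.Eventually.of_forall fun s => (hcont s).aestronglyMeasurable)
    (by simpa [proj_zero] using h.continuous.integrable_of_hasCompactSupport hc)
    (by simpa [proj_zero] using (h.continuous_dirDeriv v).aestronglyMeasurable)
    (Filter.Eventually.of_forall fun z s hs => ?_)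
    ((integrable_indicator_iff hK.measurableSet).2
      (integrableOn_const hK.measure_lt_top.ne))
    (Filter.Eventually.of_forall fun z s _ => h.hasDerivAt_line v z s)).2
  · have hconst : (fun s : ℝ => ∫ z, ψ (z + proj (s • v))) = fun _ => ∫ z, ψ z :=
      funext fun s => integral_add_right_eq_self _ _
    rw [hconst] at hderiv
    simpa [proj_zero] using hderiv.unique (hasDerivAt_const _ _)
  · by_cases hz : z ∈ K
    · simpa [hz] using hC (z + proj (s • v))
    · have : z + proj (s • v) ∉ tsupport ψ := fun hmem =>
        hz ⟨(_, s), ⟨hmem, hs⟩, by simp⟩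
      simp [hz, dirDeriv_eq_zero this]

/-! ### Mollification -/

/-- Bounded measurable real functions. -/
structure BddMeas {X : Type*} [MeasurableSpace X] (f : X → ℝ) : Prop where
  measurable : Measurable f
  bounded : ∃ C, ∀ x, |f x| ≤ C

namespace BddMeas

variable {X Y : Type*} [MeasurableSpace X] [MeasurableSpace Y] {f g : X → ℝ}

lemma const (c : ℝ) : BddMeas fun _ : X => c := ⟨measurable_const, |c|, fun _ => le_rfl⟩

lemma mul (hf : BddMeas f) (hg : BddMeas g) : BddMeas fun x => f x * g x := by
  obtain ⟨C, hC⟩ := hf.bounded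
  obtain ⟨D, hD⟩ := hg.bounded
  refine ⟨hf.measurable.mul hg.measurable, C * D, fun x => ?_⟩
  rw [abs_mul]
  exact mul_le_mul (hC x) (hD x) (abs_nonneg _) ((abs_nonneg _).trans (hC x))

lemma sub (hf : BddMeas f) (hg : BddMeas g) : BddMeas fun x => f x - g x := by
  obtain ⟨C, hC⟩ := hf.bounded
  obtain ⟨D, hD⟩ := hg.bounded
  exact ⟨hf.measurable.sub hg.measurable, C + D, fun x =>
    (abs_sub _ _).trans (add_le_add (hC x) (hD x))⟩

lemma comp (hf : BddMeas f) {φ : Y → X} (hφ : Measurable φ) : BddMeas fun y => f (φ y) :=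
  ⟨hf.measurable.comp hφ, hf.bounded.imp fun _ h y => h (φ y)⟩

lemma integrable_mul {μ : Measure X} {k : X → ℝ} (hf : BddMeas f) (hk : Integrable k μ) :
    Integrable (fun x => k x * f x) μ := by
  obtain ⟨C, hC⟩ := hf.bounded
  exact hk.mul_bdd (c := C) hf.measurable.aestronglyMeasurable (Filter.Eventually.of_forall hC)

end BddMeas

/-- A smooth probability density on `ℝ³ × ℝ`, supported in the unit ball. -/
noncomputable def kernel : Cover → ℝ :=
  (⟨1 / 2, 1, by norm_num, by norm_num⟩ : ContDiffBump (0 : Cover)).normed volume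

lemma kernel_nonneg (h : Cover) : 0 ≤ kernel h := ContDiffBump.nonneg_normed _ h

lemma integral_kernel : ∫ h, kernel h = 1 := ContDiffBump.integral_normed _

lemma kernel_eq_zero {h : Cover} (hh : ¬ ‖h‖ < 1) : kernel h = 0 := by
  by_contra hne
  have : h ∈ Function.support kernel := hne
  rw [kernel, ContDiffBump.support_normed_eq] at this
  exact hh (by simpa using this)

lemma contDiff_kernel : ContDiff ℝ ∞ kernel := ContDiffBump.contDiff_normed _

lemma hasCompactSupport_kernel : HasCompactSupport kernel :=
  ContDiffBump.hasCompactSupport_normed _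

lemma integrable_kernel : Integrable kernel :=
  contDiff_kernel.continuous.integrable_of_hasCompactSupport hasCompactSupport_kernel

/-- The average of `F` against `kernel`. -/
noncomputable def avg (F : Cover → ℝ) : ℝ := ∫ h, kernel h * F h

section avg

variable {F G : Cover → ℝ}

lemma avg_const (c : ℝ) : avg (fun _ => c) = c := by
  rw [avg, integral_mul_const, integral_kernel, one_mul]

lemma avg_sub (hF : BddMeas F) (hG : BddMeas G) :
    avg (fun h => F h - G h) = avg F - avg G := by
  simp only [avg, mul_sub]
  exact integral_sub (hF.integrable_mul integrable_kernel) (hG.integrable_mul integrable_kernel)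

lemma avg_const_mul (c : ℝ) (F : Cover → ℝ) : avg (fun h => c * F h) = c * avg F := by
  simp only [avg, mul_left_comm _ c]
  exact integral_const_mul _ _

lemma avg_mono (hF : BddMeas F) (hG : BddMeas G) (hle : ∀ h, ‖h‖ < 1 → F h ≤ G h) :
    avg F ≤ avg G := by
  refine integral_mono (hF.integrable_mul integrable_kernel)
    (hG.integrable_mul integrable_kernel) fun h => ?_
  by_cases hh : ‖h‖ < 1
  · exact mul_le_mul_of_nonneg_left (hle h hh) (kernel_nonneg h)
  · simp [kernel_eq_zero hh]

lemma avg_nonneg (hF : ∀ h, 0 ≤ F h) : 0 ≤ avg F :=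
  integral_nonneg fun h => mul_nonneg (kernel_nonneg h) (hF h)

lemma abs_avg_le_avg (hF : BddMeas F) (hG : BddMeas G)
    (hle : ∀ h, ‖h‖ < 1 → |F h| ≤ G h) : |avg F| ≤ avg G := by
  refine abs_le.2 ⟨?_, avg_mono hF hG fun h hh => (le_abs_self _).trans (hle h hh)⟩
  have h1 : avg (fun h => -1 * G h) ≤ avg F :=
    avg_mono ((BddMeas.const (-1)).mul hG) hF fun h hh => by
      linarith [neg_abs_le (F h), hle h hh]
  rw [avg_const_mul] at h1
  linarith

lemma abs_avg_sub_le (hF : BddMeas F) {a c : ℝ} (h : ∀ h, ‖h‖ < 1 → |F h - a| ≤ c) :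
    |avg F - a| ≤ c := by
  have h1 := abs_avg_le_avg (hF.sub (BddMeas.const a)) (BddMeas.const c) h
  rwa [avg_sub hF (BddMeas.const a), avg_const, avg_const] at h1

/-- The commutator of averaging with multiplication is quadratic in the oscillations. -/
lemma abs_avg_mul_sub_le (hF : BddMeas F) (hG : BddMeas G) {a b c d : ℝ}
    (h₁ : ∀ h, ‖h‖ < 1 → |F h - a| ≤ c) (h₂ : ∀ h, ‖h‖ < 1 → |G h - b| ≤ d) :
    |avg (fun h => F h * G h) - avg F * avg G| ≤ 2 * (c * d) := by
  have hc : 0 ≤ c := (abs_nonneg _).trans (h₁ 0 (by simp))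
  have h3 : |avg (fun h => (F h - a) * (G h - b))| ≤ c * d := by
    rw [← avg_const (c * d)]
    refine abs_avg_le_avg ((hF.sub (.const a)).mul (hG.sub (.const b))) (.const _) fun h hh => ?_
    rw [abs_mul]
    exact mul_le_mul (h₁ h hh) (h₂ h hh) (abs_nonneg _) hc
  have h4 : avg (fun h => (F h - a) * (G h - b)) =
      avg (fun h => F h * G h) - a * avg G - b * avg F + a * b := by
    have : (fun h => (F h - a) * (G h - b)) =
        fun h => (F h * G h - a * G h) - (b * F h - a * b) := by ext h; ring
    rw [this, avg_sub ((hF.mul hG).sub ((BddMeas.const a).mul hG))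
      (((BddMeas.const b).mul hF).sub (.const _)), avg_sub (hF.mul hG) ((BddMeas.const a).mul hG),
      avg_sub ((BddMeas.const b).mul hF) (.const _), avg_const_mul, avg_const_mul, avg_const]
    ring
  have h5 : |(avg F - a) * (avg G - b)| ≤ c * d := by
    rw [abs_mul]
    exact mul_le_mul (abs_avg_sub_le hF h₁) (abs_avg_sub_le hG h₂) (abs_nonneg _) hc
  have h6 : avg (fun h => F h * G h) - avg F * avg G =
      avg (fun h => (F h - a) * (G h - b)) - (avg F - a) * (avg G - b) := by rw [h4]; ring
  rw [h6]
  linarith [abs_sub (avg fun h => (F h - a) * (G h - b)) ((avg F - a) * (avg G - b))]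

/-- For a nonnegative weight the commutator is also controlled by the average of the weight. -/
lemma abs_avg_mul_sub_le_of_nonneg (hF : BddMeas F) (hG : BddMeas G) (hF0 : ∀ h, 0 ≤ F h)
    {b d : ℝ} (h₂ : ∀ h, ‖h‖ < 1 → |G h - b| ≤ d) :
    |avg (fun h => F h * G h) - avg F * avg G| ≤ 2 * (d * avg F) := by
  have h3 : |avg (fun h => F h * (G h - b))| ≤ d * avg F := by
    rw [← avg_const_mul]
    refine abs_avg_le_avg (hF.mul (hG.sub (.const b))) ((BddMeas.const d).mul hF) fun h hh => ?_
    rw [abs_mul, abs_of_nonneg (hF0 h), mul_comm]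
    exact mul_le_mul_of_nonneg_right (h₂ h hh) (hF0 h)
  have h4 : avg (fun h => F h * (G h - b)) = avg (fun h => F h * G h) - b * avg F := by
    have : (fun h => F h * (G h - b)) = fun h => F h * G h - b * F h := by ext h; ring
    rw [this, avg_sub (hF.mul hG) ((BddMeas.const b).mul hF), avg_const_mul]
  have h5 : |avg F * (avg G - b)| ≤ d * avg F := by
    rw [abs_mul, abs_of_nonneg (avg_nonneg hF0), mul_comm]
    exact mul_le_mul_of_nonneg_right (abs_avg_sub_le hG h₂) (avg_nonneg hF0)
  have h6 : avg (fun h => F h * G h) - avg F * avg G =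
      avg (fun h => F h * (G h - b)) - avg F * (avg G - b) := by rw [h4]; ring
  rw [h6]
  linarith [abs_sub (avg fun h => F h * (G h - b)) (avg F * (avg G - b))]

end avg

/-- The mollification of `f` at scale `ε`. -/
noncomputable def moll (ε : ℝ) (f : SpaceTime → ℝ) (z : SpaceTime) : ℝ :=
  avg fun h => f (z - proj (ε • h))

lemma measurable_sub_proj (ε : ℝ) (z : SpaceTime) :
    Measurable fun h : Cover => z - proj (ε • h) :=
  (continuous_const.sub (continuous_proj.comp (continuous_const_smul ε))).measurable

lemma BddMeas.shift {f : SpaceTime → ℝ} (hf : BddMeas f) (ε : ℝ) (z : SpaceTime) :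
    BddMeas fun h : Cover => f (z - proj (ε • h)) :=
  hf.comp (measurable_sub_proj ε z)

lemma moll_const (ε c : ℝ) : moll ε (fun _ => c) = fun _ => c := by
  ext z; exact avg_const c

section moll

open scoped Convolution

variable {f : SpaceTime → ℝ} {ε : ℝ}

lemma BddMeas.locallyIntegrable_lift (hf : BddMeas f) (ε : ℝ) :
    LocallyIntegrable (fun w : Cover => f (proj (ε • w))) := by
  obtain ⟨C, hC⟩ := hf.bounded
  have hm : Measurable fun w : Cover => f (proj (ε • w)) :=
    hf.measurable.comp (continuous_proj.comp (continuous_const_smul ε)).measurable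
  exact (locallyIntegrable_const C).mono hm.aestronglyMeasurable
    (Filter.Eventually.of_forall fun w => (hC _).trans (le_abs_self C))

lemma moll_proj (hε : ε ≠ 0) (f : SpaceTime → ℝ) (y : Cover) :
    moll ε f (proj y) = (kernel ⋆[ContinuousLinearMap.mul ℝ ℝ, volume]
      fun w => f (proj (ε • w))) (ε⁻¹ • y) := by
  simp only [moll, avg, convolution, ContinuousLinearMap.mul_apply']
  refine integral_congr_ae (Filter.Eventually.of_forall fun h => ?_)
  simp only [smul_sub, smul_inv_smul₀ hε, proj_sub]

lemma smooth_moll (hε : ε ≠ 0) (hf : BddMeas f) : Smooth (moll ε f) := by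
  have h1 : (fun y => moll ε f (proj y)) = (kernel ⋆[ContinuousLinearMap.mul ℝ ℝ, volume]
      fun w => f (proj (ε • w))) ∘ fun y => ε⁻¹ • y := funext fun y => moll_proj hε f y
  rw [Smooth, h1]
  exact (hasCompactSupport_kernel.contDiff_convolution_left _ contDiff_kernel
    (hf.locallyIntegrable_lift ε)).comp (contDiff_const_smul _)

lemma hasCompactSupport_fderiv_kernel (v : Cover) :
    HasCompactSupport fun h => fderiv ℝ kernel h v :=
  hasCompactSupport_kernel.fderiv_apply (𝕜 := ℝ) v

lemma integrable_fderiv_kernel (v : Cover) : Integrable fun h => fderiv ℝ kernel h v :=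
  ((contDiff_kernel.continuous_fderiv (by simp)).clm_apply
    continuous_const).integrable_of_hasCompactSupport (hasCompactSupport_fderiv_kernel v)

lemma dirDeriv_moll (hε : ε ≠ 0) (hf : BddMeas f) (v : Cover) (z : SpaceTime) :
    dirDeriv v (moll ε f) z = ε⁻¹ * ∫ h, fderiv ℝ kernel h v * f (z - proj (ε • h)) := by
  obtain ⟨y, rfl⟩ := isOpenQuotientMap_proj.surjective z
  have h1 : (fun y => moll ε f (proj y)) = (kernel ⋆[ContinuousLinearMap.mul ℝ ℝ, volume]
      fun w => f (proj (ε • w))) ∘ fun y => ε⁻¹ • y := funext fun y => moll_proj hε f y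
  have h2 := (hasCompactSupport_kernel.hasFDerivAt_convolution_left (ContinuousLinearMap.mul ℝ ℝ)
    (contDiff_kernel.of_le (by simp)) (hf.locallyIntegrable_lift ε) (ε⁻¹ • y)).comp y
    ((hasFDerivAt_id y).const_smul ε⁻¹)
  have h3 := hasCompactSupport_kernel.fderiv (𝕜 := ℝ) |>.convolutionExists_left
    (ContinuousLinearMap.precompL Cover (ContinuousLinearMap.mul ℝ ℝ))
    (contDiff_kernel.continuous_fderiv (by simp)) (hf.locallyIntegrable_lift ε) (ε⁻¹ • y)
  rw [(smooth_moll hε hf).dirDeriv_proj, h1, h2.fderiv]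
  simp only [ContinuousLinearMap.comp_apply, smul_apply,
    ContinuousLinearMap.id_apply, map_smul, smul_eq_mul]
  rw [convolution, ContinuousLinearMap.integral_apply h3]
  congr 1
  refine integral_congr_ae (Filter.Eventually.of_forall fun h => ?_)
  simp only [ContinuousLinearMap.precompL_apply, ContinuousLinearMap.mul_apply', smul_sub,
    smul_inv_smul₀ hε, proj_sub]

lemma integral_fderiv_kernel (v : Cover) : ∫ h, fderiv ℝ kernel h v = 0 := by
  have h := dirDeriv_moll one_ne_zero (BddMeas.const 1) v 0
  rw [moll_const, dirDeriv_const] at h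
  simpa using h.symm

/-- The `L¹` norm of the derivative of `kernel` in the direction `v`. -/
noncomputable def kernelVar (v : Cover) : ℝ := ∫ h, |fderiv ℝ kernel h v|

lemma kernelVar_nonneg (v : Cover) : 0 ≤ kernelVar v := integral_nonneg fun _ => abs_nonneg _

lemma abs_dirDeriv_moll_le (hε : 0 < ε) (hf : BddMeas f) (v : Cover) {z : SpaceTime} {a c : ℝ}
    (h : ∀ h : Cover, ‖h‖ ≤ 1 → |f (z - proj (ε • h)) - a| ≤ c) :
    |dirDeriv v (moll ε f) z| ≤ kernelVar v * (ε⁻¹ * c) := by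
  have h1 : ∫ h, fderiv ℝ kernel h v * f (z - proj (ε • h)) =
      ∫ h, fderiv ℝ kernel h v * (f (z - proj (ε • h)) - a) := by
    simp only [mul_sub]
    rw [integral_sub ((hf.shift ε z).integrable_mul (integrable_fderiv_kernel v))
      ((integrable_fderiv_kernel v).mul_const a), integral_mul_const, integral_fderiv_kernel,
      zero_mul, sub_zero]
  rw [dirDeriv_moll hε.ne' hf, h1, abs_mul, abs_of_pos (inv_pos.2 hε), mul_left_comm]
  refine mul_le_mul_of_nonneg_left ?_ (inv_pos.2 hε).le
  rw [kernelVar, ← integral_mul_const, ← Real.norm_eq_abs]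
  refine norm_integral_le_of_norm_le ((integrable_fderiv_kernel v).abs.mul_const c)
    (Filter.Eventually.of_forall fun w => ?_)
  rw [norm_mul, Real.norm_eq_abs, Real.norm_eq_abs]
  by_cases hw : ‖w‖ ≤ 1
  · exact mul_le_mul_of_nonneg_left (h w hw) (abs_nonneg _)
  · have : w ∉ tsupport kernel := by
      rw [kernel, ContDiffBump.tsupport_normed_eq]
      simpa using hw
    have hz : fderiv ℝ kernel w = 0 := by
      by_contra hne
      exact this (support_fderiv_subset ℝ hne)
    simp [hz]

end moll

/-! ### Mollified conservation laws -/

/-- The slab `𝕋³ × [r, T - r]`. -/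
def slab (T r : ℝ) : Set SpaceTime := univ ×ˢ Icc r (T - r)

lemma IsTestFunction.translate {T r ε : ℝ} {ψ : SpaceTime → ℝ} (hψ : Smooth ψ)
    (hc : HasCompactSupport ψ) (hs : tsupport ψ ⊆ slab T r) (hε : 0 < ε) (hεr : ε ≤ r)
    {h : Cover} (hh : ‖h‖ < 1) : IsTestFunction T fun z => ψ (z + proj (ε • h)) := by
  refine ⟨hψ.translate _, hc.comp_homeomorph (Homeomorph.addRight _), ?_⟩
  have h1 : tsupport (fun z => ψ (z + proj (ε • h))) =
      (Homeomorph.addRight (proj (ε • h))) ⁻¹' tsupport ψ :=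
    tsupport_comp_eq_preimage ψ (Homeomorph.addRight (proj (ε • h)))
  rw [h1]
  intro z hz
  have h2 : z.2 + ε * h.2 ∈ Icc r (T - r) := (hs hz).2
  have h3 : |ε * h.2| < r := by
    rw [abs_mul, abs_of_pos hε]
    have : |h.2| < 1 := (norm_snd_le h).trans_lt hh
    nlinarith
  rw [abs_lt] at h3
  exact ⟨mem_univ _, by linarith [h2.1], by linarith [h2.2]⟩

/-- A bounded weak solution of `∑ k, ∂_k F_k = 0` remains one after mollification, against test
functions that stay away from the boundary. -/
lemma sum_integral_moll_mul_dirDeriv {T r ε : ℝ} {F : Option (Fin 3) → SpaceTime → ℝ}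
    (hF : ∀ k, BddMeas (F k))
    (hweak : ∀ ψ, IsTestFunction T ψ → ∑ k, ∫ z, F k z * dirDeriv (axis k) ψ z = 0)
    {ψ : SpaceTime → ℝ} (hψ : Smooth ψ) (hc : HasCompactSupport ψ) (hs : tsupport ψ ⊆ slab T r)
    (hε : 0 < ε) (hεr : ε ≤ r) :
    ∑ k, ∫ z, moll ε (F k) z * dirDeriv (axis k) ψ z = 0 := by
  have hD : ∀ k, Integrable (dirDeriv (axis k) ψ) := fun k =>
    (hψ.continuous_dirDeriv _).integrable_of_hasCompactSupport
      (hc.of_isClosed_subset (isClosed_tsupport _) (tsupport_dirDeriv_subset ψ _))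
  have hint : ∀ k, Integrable (fun p : SpaceTime × Cover =>
      dirDeriv (axis k) ψ p.1 * kernel p.2 * F k (p.1 - proj (ε • p.2))) (volume.prod volume) :=
    fun k => ((hF k).comp (φ := fun p : SpaceTime × Cover => p.1 - proj (ε • p.2))
      (continuous_fst.sub (continuous_proj.comp (continuous_snd.const_smul ε))).measurable
      ).integrable_mul ((hD k).mul_prod integrable_kernel)
  have hswap : ∀ k, ∫ z, moll ε (F k) z * dirDeriv (axis k) ψ z =
      ∫ h, kernel h * ∫ z, F k z * dirDeriv (axis k) ψ (z + proj (ε • h)) := by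
    intro k
    have h1 : ∀ z, moll ε (F k) z * dirDeriv (axis k) ψ z =
        ∫ h, dirDeriv (axis k) ψ z * kernel h * F k (z - proj (ε • h)) := by
      intro z
      rw [moll, avg, mul_comm, ← integral_const_mul]
      simp only [mul_assoc]
    have h2 : ∀ h, kernel h * ∫ z, F k z * dirDeriv (axis k) ψ (z + proj (ε • h)) =
        ∫ z, dirDeriv (axis k) ψ z * kernel h * F k (z - proj (ε • h)) := by
      intro h
      rw [← integral_add_right_eq_self (μ := volume)
        (fun z => dirDeriv (axis k) ψ z * kernel h * F k (z - proj (ε • h))) (proj (ε • h)),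
        ← integral_const_mul]
      refine integral_congr_ae (Filter.Eventually.of_forall fun z => ?_)
      simp only [add_sub_cancel_right]
      ring
    simp only [h1, h2]
    exact integral_integral_swap (hint k)
  have hint' : ∀ k, Integrable fun h =>
      kernel h * ∫ z, F k z * dirDeriv (axis k) ψ (z + proj (ε • h)) := by
    intro k
    refine (hint k).integral_prod_right.congr (Filter.Eventually.of_forall fun h => ?_)
    simp only
    rw [← integral_add_right_eq_self (μ := volume)
      (fun z => dirDeriv (axis k) ψ z * kernel h * F k (z - proj (ε • h))) (proj (ε • h)),
      ← integral_const_mul]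
    refine integral_congr_ae (Filter.Eventually.of_forall fun z => ?_)
    simp only [add_sub_cancel_right]
    ring
  simp only [hswap]
  rw [← integral_finsetSum _ fun k _ => hint' k]
  refine integral_eq_zero_of_ae (Filter.Eventually.of_forall fun h => ?_)
  simp only [← Finset.mul_sum, Pi.zero_apply, mul_eq_zero]
  by_cases hh : ‖h‖ < 1
  · right
    have := hweak _ (IsTestFunction.translate hψ hc hs hε hεr hh)
    simpa only [dirDeriv_translate] using this
  · exact Or.inl (kernel_eq_zero hh)

/-! ### The energy identity with residuals -/

/-- The integrand of the weak form of the energy balance with test function `φ`, for a density `σ`,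
a mass flux `m` (with `m none` the mass density) and a velocity `W` (with `W none = 1`). The
pressure potential is `r ^ γ / (γ - 1)`, which differs from `pressurePotential` by a multiple of
`r`. The mass flux is kept as a separate argument because mollification does not commute with the
product of density and velocity. -/
noncomputable def energyPairing (γ : ℝ) (m W : Option (Fin 3) → SpaceTime → ℝ) (σ φ : SpaceTime → ℝ)
    (z : SpaceTime) : ℝ :=
  ∑ k, (1 / 2 * m k z * ∑ i : Fin 3, W (some i) z ^ 2 + σ z ^ γ / (γ - 1) * W k z) *
      dirDeriv (axis k) φ z +
    ∑ i : Fin 3, σ z ^ γ * W (some i) z * dirDeriv (axis (some i)) φ z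

/-- The difference between a momentum flux `N i k` and the flux formed from the mass flux `m`, the
velocity `W` and the density `σ`. -/
noncomputable def momentumResidual (γ : ℝ) (N : Fin 3 → Option (Fin 3) → SpaceTime → ℝ)
    (m W : Option (Fin 3) → SpaceTime → ℝ) (σ : SpaceTime → ℝ) (i : Fin 3) (k : Option (Fin 3))
    (z : SpaceTime) : ℝ :=
  N i k z - m k z * W (some i) z - if k = some i then σ z ^ γ else 0

/-- The residuals of the momentum and mass fluxes, tested against the factors by which the two
equations are multiplied in the derivation of the energy balance. -/
noncomputable def energyError (γ : ℝ) (N : Fin 3 → Option (Fin 3) → SpaceTime → ℝ)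
    (m W : Option (Fin 3) → SpaceTime → ℝ) (σ φ : SpaceTime → ℝ) (z : SpaceTime) : ℝ :=
  γ / (γ - 1) * ∑ k, (σ z * W k z - m k z) *
      dirDeriv (axis k) (fun z => φ z * σ z ^ (γ - 1)) z -
    ∑ i, ∑ k, momentumResidual γ N m W σ i k z *
      dirDeriv (axis k) (fun z => φ z * W (some i) z) z

lemma Smooth.integrable_mul_dirDeriv {f ψ : SpaceTime → ℝ} (hf : Continuous f) (hψ : Smooth ψ)
    (hc : HasCompactSupport ψ) (v : Cover) : Integrable fun z => f z * dirDeriv v ψ z := by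
  have h1 : HasCompactSupport (dirDeriv v ψ) :=
    hc.of_isClosed_subset (isClosed_tsupport _) (tsupport_dirDeriv_subset ψ v)
  exact (hf.mul (hψ.continuous_dirDeriv v)).integrable_of_hasCompactSupport h1.mul_left

section identity

variable {γ : ℝ} {N : Fin 3 → Option (Fin 3) → SpaceTime → ℝ}
  {m W : Option (Fin 3) → SpaceTime → ℝ} {σ φ : SpaceTime → ℝ}

lemma energyPairing_sub_energyError (hγ : γ - 1 ≠ 0) (hW : ∀ k, Smooth (W k))
    (hW1 : W none = fun _ => 1) (hσ : Smooth σ) (hpos : ∀ z, 0 < σ z) (hφ : Smooth φ)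
    (z : SpaceTime) :
    energyPairing γ m W σ φ z - energyError γ N m W σ φ z =
      ∑ i, ∑ k, N i k z * dirDeriv (axis k) (fun z => φ z * W (some i) z) z -
      1 / 2 * ∑ i : Fin 3, ∑ k,
        m k z * dirDeriv (axis k) (fun z => φ z * (W (some i) z * W (some i) z)) z +
      γ / (γ - 1) * ∑ k, m k z * dirDeriv (axis k) (fun z => φ z * σ z ^ (γ - 1)) z -
      ∑ k, dirDeriv (axis k) (fun z => φ z * (σ z ^ γ * W k z)) z := by
  have e1 : σ z ^ (γ - 1) = σ z * σ z ^ (γ - 1 - 1) := by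
    rw [mul_comm, ← Real.rpow_add_one (hpos z).ne', sub_add_cancel]
  have e2 : σ z ^ γ = σ z * σ z ^ (γ - 1) := by
    rw [mul_comm, ← Real.rpow_add_one (hpos z).ne', sub_add_cancel]
  have h1 : ∀ k i, dirDeriv (axis k) (fun z => φ z * W (some i) z) z = _ := fun k i =>
    hφ.dirDeriv_mul (hW (some i)) (axis k) z
  have h2 : ∀ k i, dirDeriv (axis k) (fun z => φ z * (W (some i) z * W (some i) z)) z = _ :=
    fun k i => (hφ.dirDeriv_mul ((hW (some i)).mul (hW (some i))) (axis k) z).trans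
      (by rw [(hW (some i)).dirDeriv_mul (hW (some i))])
  have h3 : ∀ k, dirDeriv (axis k) (fun z => φ z * σ z ^ (γ - 1)) z = _ := fun k =>
    (hφ.dirDeriv_mul (hσ.rpow hpos (γ - 1)) (axis k) z).trans (by rw [hσ.dirDeriv_rpow hpos])
  have h4 : ∀ k, dirDeriv (axis k) (fun z => φ z * (σ z ^ γ * W k z)) z = _ := fun k =>
    (hφ.dirDeriv_mul ((hσ.rpow hpos γ).mul (hW k)) (axis k) z).trans
      (by rw [(hσ.rpow hpos γ).dirDeriv_mul (hW k), hσ.dirDeriv_rpow hpos])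
  have h5 : ∀ v, dirDeriv v (W none) z = 0 := fun v => by rw [hW1, dirDeriv_const]
  have h6 : W none z = 1 := by rw [hW1]
  simp only [energyPairing, energyError, momentumResidual, h1, h2, h3, h4, e2, e1]
  generalize σ z ^ (γ - 1 - 1) = g
  simp only [Fintype.sum_option, Fin.sum_univ_three, h5, h6, reduceCtorEq, if_false,
    Option.some.injEq, Fin.reduceEq, if_true, Fin.isValue]
  field_simp
  ring

/-- Multiplying the momentum equation by `φ W` and the mass equation by `φ |W|² / 2` and
`φ σ ^ (γ - 1)` gives the energy balance up to the residuals of the fluxes. -/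
lemma integral_energyPairing_eq (hγ : γ - 1 ≠ 0) (hN : ∀ i k, Continuous (N i k))
    (hm : ∀ k, Continuous (m k)) (hW : ∀ k, Smooth (W k)) (hW1 : W none = fun _ => 1)
    (hσ : Smooth σ) (hpos : ∀ z, 0 < σ z) (hφ : Smooth φ) (hc : HasCompactSupport φ)
    (hmass : ∀ ψ, Smooth ψ → tsupport ψ ⊆ tsupport φ →
      ∑ k, ∫ z, m k z * dirDeriv (axis k) ψ z = 0)
    (hmom : ∀ i ψ, Smooth ψ → tsupport ψ ⊆ tsupport φ →
      ∑ k, ∫ z, N i k z * dirDeriv (axis k) ψ z = 0) :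
    ∫ z, energyPairing γ m W σ φ z = ∫ z, energyError γ N m W σ φ z := by
  have hs : ∀ g : SpaceTime → ℝ, tsupport (fun z => φ z * g z) ⊆ tsupport φ := fun g =>
    tsupport_mul_subset_left
  have hcs : ∀ g : SpaceTime → ℝ, HasCompactSupport (fun z => φ z * g z) := fun g =>
    hc.mul_right
  have s1 : ∀ i : Fin 3, Smooth fun z => φ z * W (some i) z := fun i => hφ.mul (hW _)
  have s2 : ∀ i : Fin 3, Smooth fun z => φ z * (W (some i) z * W (some i) z) := fun i =>
    hφ.mul ((hW _).mul (hW _))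
  have s3 : Smooth fun z => φ z * σ z ^ (γ - 1) := hφ.mul (hσ.rpow hpos _)
  have s4 : ∀ k, Smooth fun z => φ z * (σ z ^ γ * W k z) := fun k =>
    hφ.mul ((hσ.rpow hpos _).mul (hW k))
  have i1 : ∀ i k, Integrable fun z =>
      N i k z * dirDeriv (axis k) (fun z => φ z * W (some i) z) z := fun i k =>
    (s1 i).integrable_mul_dirDeriv (hN i k) (hcs _) _
  have i2 : ∀ (i : Fin 3) k, Integrable fun z =>
      m k z * dirDeriv (axis k) (fun z => φ z * (W (some i) z * W (some i) z)) z := fun i k =>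
    (s2 i).integrable_mul_dirDeriv (hm k) (hcs _) _
  have i3 : ∀ k, Integrable fun z =>
      m k z * dirDeriv (axis k) (fun z => φ z * σ z ^ (γ - 1)) z := fun k =>
    s3.integrable_mul_dirDeriv (hm k) (hcs _) _
  have i4 : ∀ k, Integrable fun z =>
      dirDeriv (axis k) (fun z => φ z * (σ z ^ γ * W k z)) z := fun k => by
    simpa using (s4 k).integrable_mul_dirDeriv (f := fun _ => 1) continuous_const (hcs _) _
  have hπ : Continuous fun z => σ z ^ γ := (hσ.rpow hpos _).continuous
  have hWc : ∀ k, Continuous (W k) := fun k => (hW k).continuous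
  have iP : Integrable (energyPairing γ m W σ φ) := by
    refine Integrable.add (integrable_finsetSum _ fun k _ => ?_)
      (integrable_finsetSum _ fun i _ => ?_)
    · have := hm k
      exact hφ.integrable_mul_dirDeriv (by fun_prop) hc _
    · exact hφ.integrable_mul_dirDeriv (by fun_prop) hc _
  have iE : Integrable (energyError γ N m W σ φ) := by
    refine Integrable.sub (Integrable.const_mul (integrable_finsetSum _ fun k _ => ?_) _)
      (integrable_finsetSum _ fun i _ => integrable_finsetSum _ fun k _ => ?_)
    · have := hm k
      exact s3.integrable_mul_dirDeriv ((hσ.continuous.mul (hWc k)).sub this) (hcs _) _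
    · refine (s1 i).integrable_mul_dirDeriv ?_ (hcs _) _
      refine ((hN i k).sub ((hm k).mul (hWc _))).sub ?_
      split_ifs
      exacts [hπ, continuous_const]
  rw [← sub_eq_zero, ← integral_sub iP iE]
  simp only [energyPairing_sub_energyError hγ hW hW1 hσ hpos hφ]
  rw [integral_sub, integral_add, integral_sub, integral_const_mul, integral_const_mul]
  · simp only [integral_finsetSum _ fun i _ => integrable_finsetSum Finset.univ fun k _ => i1 i k,
      integral_finsetSum _ fun i _ => integrable_finsetSum Finset.univ fun k _ => i2 i k,
      integral_finsetSum Finset.univ fun k _ => i1 _ k,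
      integral_finsetSum Finset.univ fun k _ => i2 _ k,
      integral_finsetSum Finset.univ fun k _ => i3 k,
      integral_finsetSum Finset.univ fun k _ => i4 k,
      hmom _ _ (s1 _) (hs _), hmass _ (s2 _) (hs _), hmass _ s3 (hs _),
      integral_dirDeriv_eq_zero (s4 _) (hcs _)]
    simp
  · exact integrable_finsetSum _ fun i _ => integrable_finsetSum _ fun k _ => i1 i k
  · exact (integrable_finsetSum _ fun i _ => integrable_finsetSum _ fun k _ => i2 i k).const_mul _
  · exact (integrable_finsetSum _ fun i _ => integrable_finsetSum _ fun k _ => i1 i k).sub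
      ((integrable_finsetSum _ fun i _ => integrable_finsetSum _ fun k _ => i2 i k).const_mul _)
  · exact (integrable_finsetSum _ fun k _ => i3 k).const_mul _
  · exact ((integrable_finsetSum _ fun i _ => integrable_finsetSum _ fun k _ => i1 i k).sub
      ((integrable_finsetSum _ fun i _ => integrable_finsetSum _ fun k _ => i2 i k).const_mul
        _)).add ((integrable_finsetSum _ fun k _ => i3 k).const_mul _)
  · exact integrable_finsetSum _ fun k _ => i4 k

end identity

/-! ### Inequalities for powers -/

lemma abs_rpow_sub_rpow_le {a b p : ℝ} (ha : 0 ≤ a) (hb : 0 ≤ b) (hp0 : 0 ≤ p) (hp1 : p ≤ 1) :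
    |b ^ p - a ^ p| ≤ |b - a| ^ p := by
  wlog hab : a ≤ b generalizing a b
  · rw [abs_sub_comm, abs_sub_comm b]
    exact this hb ha (le_of_not_ge hab)
  rw [abs_of_nonneg (sub_nonneg.2 hab),
    abs_of_nonneg (sub_nonneg.2 (Real.rpow_le_rpow ha hab hp0))]
  have := Real.rpow_add_le_add_rpow (sub_nonneg.2 hab) ha hp0 hp1
  rw [sub_add_cancel] at this
  linarith

/-- The graph of `x ↦ x ^ γ` lies above its tangents. -/
lemma rpow_tangent_le {a b γ : ℝ} (ha : 0 ≤ a) (hb : 0 ≤ b) (hγ : 1 < γ) :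
    a ^ γ + γ * a ^ (γ - 1) * (b - a) ≤ b ^ γ := by
  rcases ha.eq_or_lt with rfl | ha
  · rw [Real.zero_rpow (by linarith), Real.zero_rpow (by linarith)]
    simpa using Real.rpow_nonneg hb γ
  · have h1 := one_add_mul_self_le_rpow_one_add (s := b / a - 1) (p := γ)
      (by linarith [div_nonneg hb ha.le]) hγ.le
    rw [add_sub_cancel, Real.div_rpow hb ha.le] at h1
    have h2 := mul_le_mul_of_nonneg_left h1 (Real.rpow_nonneg ha.le γ)
    have h3 : a ^ γ * (b ^ γ / a ^ γ) = b ^ γ := by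
      field_simp [(Real.rpow_pos_of_pos ha γ).ne']
    have h4 : a ^ γ = a ^ (γ - 1) * a := by
      rw [← Real.rpow_add_one ha.ne', sub_add_cancel]
    rw [h3] at h2
    refine le_trans (le_of_eq ?_) h2
    rw [h4]
    field_simp

/-- The pressure `x ^ γ` is of class `C^{1, γ - 1}` up to the vacuum `x = 0`. -/
lemma abs_rpow_taylor_le {a b γ : ℝ} (ha : 0 ≤ a) (hb : 0 ≤ b) (hγ₁ : 1 < γ) (hγ₂ : γ < 2) :
    |b ^ γ - a ^ γ - γ * a ^ (γ - 1) * (b - a)| ≤ γ * |b - a| ^ γ := by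
  have h1 := rpow_tangent_le ha hb hγ₁
  have h2 := rpow_tangent_le hb ha hγ₁
  have h3 : (b ^ (γ - 1) - a ^ (γ - 1)) * (b - a) ≤ |b - a| ^ γ := by
    calc (b ^ (γ - 1) - a ^ (γ - 1)) * (b - a)
        ≤ |b ^ (γ - 1) - a ^ (γ - 1)| * |b - a| := by
          rw [← abs_mul]; exact le_abs_self _
      _ ≤ |b - a| ^ (γ - 1) * |b - a| := by
          gcongr
          exact abs_rpow_sub_rpow_le ha hb (by linarith) (by linarith)
      _ = |b - a| ^ γ := by
          rw [← Real.rpow_add_one' (abs_nonneg _) (by linarith), sub_add_cancel]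
  rw [abs_of_nonneg (by linarith)]
  nlinarith

lemma min_mul_rpow_le {γ s x y : ℝ} (hs : 0 < s) (hx : 0 < x) (hγ₁ : 1 < γ) (hγ₂ : γ < 2)
    (h₁ : y ≤ s) (h₂ : y ≤ x) : y * s ^ (γ - 1 - 1) ≤ x ^ (γ - 1) := by
  rcases le_total s x with h | h
  · calc y * s ^ (γ - 1 - 1) ≤ s * s ^ (γ - 1 - 1) := by gcongr
      _ = s ^ (γ - 1) := by rw [mul_comm, ← Real.rpow_add_one hs.ne', sub_add_cancel]
      _ ≤ x ^ (γ - 1) := Real.rpow_le_rpow hs.le h (by linarith)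
  · calc y * s ^ (γ - 1 - 1) ≤ x * s ^ (γ - 1 - 1) := by gcongr
      _ ≤ x * x ^ (γ - 1 - 1) := by
        gcongr ?_ * ?_
        exact Real.rpow_le_rpow_of_nonpos hx h (by linarith)
      _ = x ^ (γ - 1) := by rw [mul_comm, ← Real.rpow_add_one hx.ne', sub_add_cancel]

/-! ### Hölder states and commutator estimates -/

/-- The velocity of space-time, with time component `1`. -/
def fourVel (w : Fin 3 → SpaceTime → ℝ) : Option (Fin 3) → SpaceTime → ℝ
  | none => fun _ => 1
  | some i => w i

/-- The flux of the `i`-th component of momentum. -/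
noncomputable def momFlux (γ : ℝ) (r : SpaceTime → ℝ) (w : Fin 3 → SpaceTime → ℝ) (i : Fin 3)
    (k : Option (Fin 3)) (z : SpaceTime) : ℝ :=
  r z * fourVel w k z * w i z + if k = some i then r z ^ γ else 0

/-- A density `r` and a velocity `w`, defined and bounded on all of space-time, which satisfy
Hölder conditions on the cylinder, with one constant `C` for all bounds. -/
structure HolderState (T α β C : ℝ) (r : SpaceTime → ℝ) (w : Fin 3 → SpaceTime → ℝ) : Prop where
  one_le : 1 ≤ C
  nonneg : ∀ z, 0 ≤ r z
  measurable_dens : Measurable r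
  measurable_vel : ∀ i, Measurable (w i)
  dens_le : ∀ z, r z ≤ C
  vel_le : ∀ i z, |w i z| ≤ C
  flux_holder : ∀ k, ∀ x ∈ cylinder T, ∀ y ∈ cylinder T,
    |r x * fourVel w k x - r y * fourVel w k y| ≤ C * dist x y ^ α
  vel_holder : ∀ i, ∀ x ∈ cylinder T, ∀ y ∈ cylinder T, |w i x - w i y| ≤ C * dist x y ^ β

namespace HolderState

variable {T α β γ C : ℝ} {r : SpaceTime → ℝ} {w : Fin 3 → SpaceTime → ℝ}

lemma bddMeas_dens (S : HolderState T α β C r w) : BddMeas r :=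
  ⟨S.measurable_dens, C, fun z => by rw [abs_of_nonneg (S.nonneg z)]; exact S.dens_le z⟩

lemma bddMeas_fourVel (S : HolderState T α β C r w) (k : Option (Fin 3)) :
    BddMeas (fourVel w k) := by
  cases k with
  | none => exact BddMeas.const 1
  | some i => exact ⟨S.measurable_vel i, C, S.vel_le i⟩

lemma fourVel_le (S : HolderState T α β C r w) (k : Option (Fin 3)) (z : SpaceTime) :
    |fourVel w k z| ≤ C := by
  cases k with
  | none => simpa [fourVel] using S.one_le
  | some i => exact S.vel_le i z

lemma bddMeas_flux (S : HolderState T α β C r w) (k : Option (Fin 3)) :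
    BddMeas fun z => r z * fourVel w k z :=
  S.bddMeas_dens.mul (S.bddMeas_fourVel k)

lemma bddMeas_pressure (S : HolderState T α β C r w) (hγ : 0 ≤ γ) : BddMeas fun z => r z ^ γ :=
  ⟨S.measurable_dens.pow_const γ, C ^ γ, fun z => by
    rw [abs_of_nonneg (Real.rpow_nonneg (S.nonneg z) γ)]
    exact Real.rpow_le_rpow (S.nonneg z) (S.dens_le z) hγ⟩

lemma bddMeas_momFlux (S : HolderState T α β C r w) (hγ : 0 ≤ γ) (i : Fin 3)
    (k : Option (Fin 3)) : BddMeas (momFlux γ r w i k) := by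
  have h1 := (S.bddMeas_flux k).mul (S.bddMeas_fourVel (some i))
  by_cases h : k = some i
  · have h2 := h1.sub ((BddMeas.const (-1)).mul (S.bddMeas_pressure hγ))
    refine (congrArg BddMeas (funext fun z => ?_)).mp h2
    simp [momFlux, h, fourVel]
  · refine (congrArg BddMeas (funext fun z => ?_)).mp h1
    simp [momFlux, h, fourVel]

end HolderState

lemma sub_proj_mem_cylinder {T R ε : ℝ} {z : SpaceTime} (hz : z ∈ slab T R) (hε : 0 < ε)
    (hεR : ε < R) {h : Cover} (hh : ‖h‖ ≤ 1) : z - proj (ε • h) ∈ cylinder T := by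
  have h2 : z.2 ∈ Icc R (T - R) := hz.2
  have h3 : |ε * h.2| < R := by
    rw [abs_mul, abs_of_pos hε]
    have : |h.2| ≤ 1 := (norm_snd_le h).trans hh
    nlinarith
  rw [abs_lt] at h3
  refine ⟨mem_univ _, ?_, ?_⟩
  · change 0 < z.2 - ε * h.2; linarith [h2.1]
  · change z.2 - ε * h.2 < T; linarith [h2.2]

lemma slab_subset_cylinder {T R : ℝ} (hR : 0 < R) : slab T R ⊆ cylinder T := fun _ hz =>
  ⟨mem_univ _, hR.trans_le hz.2.1, hz.2.2.trans_lt (by linarith)⟩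

lemma abs_shift_sub_le {T R ε a C : ℝ} {f : SpaceTime → ℝ} (hC : 0 ≤ C) (ha : 0 ≤ a)
    (hf : ∀ x ∈ cylinder T, ∀ y ∈ cylinder T, |f x - f y| ≤ C * dist x y ^ a)
    {z : SpaceTime} (hz : z ∈ slab T R) (hε : 0 < ε) (hεR : ε < R) {h : Cover} (hh : ‖h‖ ≤ 1) :
    |f (z - proj (ε • h)) - f z| ≤ C * ε ^ a := by
  refine (hf _ (sub_proj_mem_cylinder hz hε hεR hh) _
    (slab_subset_cylinder (hε.trans hεR) hz)).trans ?_
  refine mul_le_mul_of_nonneg_left (Real.rpow_le_rpow dist_nonneg ?_ ha) hC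
  refine (dist_sub_proj_le _ _).trans ?_
  rw [norm_smul, Real.norm_eq_abs, abs_of_pos hε]
  nlinarith

namespace HolderState

section estimates

variable {T α β γ C : ℝ} {r : SpaceTime → ℝ} {w : Fin 3 → SpaceTime → ℝ}
  {R ε δ : ℝ} {z : SpaceTime}

lemma fourVel_holder (S : HolderState T α β C r w) (k : Option (Fin 3)) :
    ∀ x ∈ cylinder T, ∀ y ∈ cylinder T,
      |fourVel w k x - fourVel w k y| ≤ C * dist x y ^ β := by
  cases k with
  | none =>
    intro x _ y _
    simpa [fourVel] using mul_nonneg (zero_le_one.trans S.one_le) (Real.rpow_nonneg dist_nonneg β)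
  | some i => exact S.vel_holder i

lemma dens_holder (S : HolderState T α β C r w) :
    ∀ x ∈ cylinder T, ∀ y ∈ cylinder T, |r x - r y| ≤ C * dist x y ^ α := by
  simpa [fourVel] using S.flux_holder none

lemma moll_dens_nonneg (S : HolderState T α β C r w) (ε : ℝ) (z : SpaceTime) : 0 ≤ moll ε r z :=
  avg_nonneg fun _ => S.nonneg _

lemma moll_dens_le (S : HolderState T α β C r w) (ε : ℝ) (z : SpaceTime) : moll ε r z ≤ C := by
  refine (avg_mono (S.bddMeas_dens.shift ε z) (.const C) fun h _ => S.dens_le _).trans ?_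
  rw [avg_const]

lemma abs_moll_fourVel_le (S : HolderState T α β C r w) (ε : ℝ) (k : Option (Fin 3))
    (z : SpaceTime) : |moll ε (fourVel w k) z| ≤ C := by
  refine (abs_avg_le_avg ((S.bddMeas_fourVel k).shift ε z) (.const C)
    fun h _ => S.fourVel_le k _).trans ?_
  rw [avg_const]

lemma abs_dirDeriv_moll_fourVel_le (S : HolderState T α β C r w) (hβ : 0 ≤ β)
    (hz : z ∈ slab T R) (hε : 0 < ε) (hεR : ε < R) (k : Option (Fin 3)) (v : Cover) :
    |dirDeriv v (moll ε (fourVel w k)) z| ≤ kernelVar v * (ε⁻¹ * (C * ε ^ β)) :=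
  abs_dirDeriv_moll_le hε (S.bddMeas_fourVel k) v fun _ hh =>
    abs_shift_sub_le (zero_le_one.trans S.one_le) hβ (S.fourVel_holder k) hz hε hεR hh

lemma abs_dirDeriv_moll_dens_le (S : HolderState T α β C r w) (hα : 0 ≤ α)
    (hz : z ∈ slab T R) (hε : 0 < ε) (hεR : ε < R) (v : Cover) :
    |dirDeriv v (moll ε r) z| ≤ kernelVar v * (ε⁻¹ * (C * ε ^ α)) :=
  abs_dirDeriv_moll_le hε S.bddMeas_dens v fun _ hh =>
    abs_shift_sub_le (zero_le_one.trans S.one_le) hα S.dens_holder hz hε hεR hh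

lemma abs_mass_commutator_le (S : HolderState T α β C r w) (hα : 0 ≤ α) (hβ : 0 ≤ β)
    (hz : z ∈ slab T R) (hε : 0 < ε) (hεR : ε < R) (k : Option (Fin 3)) :
    |moll ε (fun z => r z * fourVel w k z) z - moll ε r z * moll ε (fourVel w k) z| ≤
      2 * C ^ 2 * ε ^ β * min (moll ε r z) (ε ^ α) := by
  have hC := zero_le_one.trans S.one_le
  have hv : ∀ h : Cover, ‖h‖ < 1 →
      |fourVel w k (z - proj (ε • h)) - fourVel w k z| ≤ C * ε ^ β := fun h hh =>
    abs_shift_sub_le hC hβ (S.fourVel_holder k) hz hε hεR hh.le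
  have h1 := abs_avg_mul_sub_le (S.bddMeas_dens.shift ε z) ((S.bddMeas_fourVel k).shift ε z)
    (fun h hh => abs_shift_sub_le hC hα S.dens_holder hz hε hεR hh.le) hv
  have h2 := abs_avg_mul_sub_le_of_nonneg (S.bddMeas_dens.shift ε z)
    ((S.bddMeas_fourVel k).shift ε z) (fun h => S.nonneg _) hv
  have h3 : 2 * (C * ε ^ β * moll ε r z) ≤ 2 * C ^ 2 * ε ^ β * moll ε r z := by
    have : 0 ≤ ε ^ β * moll ε r z :=
      mul_nonneg (Real.rpow_nonneg hε.le _) (S.moll_dens_nonneg ε z)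
    nlinarith [S.one_le, mul_nonneg this hC]
  rcases min_choice (moll ε r z) (ε ^ α) with h | h <;> rw [h]
  · exact h2.trans h3
  · exact h1.trans (le_of_eq (by ring))

lemma abs_momentum_commutator_le (S : HolderState T α β C r w) (hα : 0 ≤ α) (hβ : 0 ≤ β)
    (hz : z ∈ slab T R) (hε : 0 < ε) (hεR : ε < R) (i : Fin 3) (k : Option (Fin 3)) :
    |moll ε (fun z => r z * fourVel w k z * w i z) z -
        moll ε (fun z => r z * fourVel w k z) z * moll ε (w i) z| ≤
      2 * C ^ 2 * ε ^ α * ε ^ β := by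
  have hC := zero_le_one.trans S.one_le
  have h1 := abs_avg_mul_sub_le ((S.bddMeas_flux k).shift ε z)
    ((S.bddMeas_fourVel (some i)).shift ε z)
    (fun h hh => abs_shift_sub_le hC hα (S.flux_holder k) hz hε hεR hh.le)
    (fun h hh => abs_shift_sub_le hC hβ (S.fourVel_holder (some i)) hz hε hεR hh.le)
  exact h1.trans (le_of_eq (by ring))

/-- The pressure commutator: the first-order Taylor term averages out, up to the shift `δ`. -/
lemma abs_pressure_commutator_le (S : HolderState T α β C r w) (hα : 0 ≤ α) (hα1 : α ≤ 1)
    (hγ₁ : 1 < γ) (hγ₂ : γ < 2) (hz : z ∈ slab T R) (hε : 0 < ε) (hε1 : ε ≤ 1) (hεR : ε < R)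
    (hδ : 0 < δ) (hδε : δ ≤ ε) :
    |moll ε (fun z => r z ^ γ) z - (moll ε r z + δ) ^ γ| ≤
      18 * C ^ 2 * (ε ^ α) ^ γ + 4 * C * ε := by
  have hC := zero_le_one.trans S.one_le
  set a := moll ε r z + δ with ha
  have ha0 : 0 < a := add_pos_of_nonneg_of_pos (S.moll_dens_nonneg ε z) hδ
  have ha2 : a ≤ 2 * C := by linarith [S.moll_dens_le ε z, S.one_le]
  have hεα : ε ≤ ε ^ α := by
    simpa using Real.rpow_le_rpow_of_exponent_ge hε hε1 hα1
  have hr : ∀ h : Cover, ‖h‖ < 1 → |r (z - proj (ε • h)) - r z| ≤ C * ε ^ α := fun h hh =>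
    abs_shift_sub_le hC hα S.dens_holder hz hε hεR hh.le
  have hm : |moll ε r z - r z| ≤ C * ε ^ α := abs_avg_sub_le (S.bddMeas_dens.shift ε z) hr
  have hra : ∀ h : Cover, ‖h‖ < 1 → |r (z - proj (ε • h)) - a| ≤ 3 * C * ε ^ α := by
    intro h hh
    have h1 := abs_le.1 (hr h hh)
    have h2 := abs_le.1 hm
    have h3 : δ ≤ C * ε ^ α := by nlinarith [S.one_le]
    exact abs_le.2 ⟨by linarith [h1.1, h2.2], by linarith [h1.2, h2.1]⟩
  have hbr : BddMeas fun h : Cover => r (z - proj (ε • h)) := S.bddMeas_dens.shift ε z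
  have hbp : BddMeas fun h : Cover => r (z - proj (ε • h)) ^ γ :=
    (S.bddMeas_pressure (by linarith)).shift ε z
  set g := γ * a ^ (γ - 1) with hg
  have key : |avg (fun h => r (z - proj (ε • h)) ^ γ - g * r (z - proj (ε • h))) -
      (a ^ γ - g * a)| ≤ 18 * C ^ 2 * (ε ^ α) ^ γ := by
    refine abs_avg_sub_le (hbp.sub ((BddMeas.const g).mul hbr)) fun h hh => ?_
    have h1 := abs_rpow_taylor_le ha0.le (S.nonneg (z - proj (ε • h))) hγ₁ hγ₂
    calc _ = |r (z - proj (ε • h)) ^ γ - a ^ γ - g * (r (z - proj (ε • h)) - a)| := by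
          congr 1; ring
      _ ≤ γ * |r (z - proj (ε • h)) - a| ^ γ := h1
      _ ≤ γ * (3 * C * ε ^ α) ^ γ := by
          gcongr
          exact hra h hh
      _ = γ * ((3 * C) ^ γ * (ε ^ α) ^ γ) := by
          rw [Real.mul_rpow (by positivity) (by positivity)]
      _ ≤ 2 * ((3 * C) ^ (2 : ℝ) * (ε ^ α) ^ γ) := by
          gcongr
          linarith [S.one_le]
      _ = 18 * C ^ 2 * (ε ^ α) ^ γ := by rw [Real.rpow_two]; ring
  rw [avg_sub hbp ((BddMeas.const g).mul hbr), avg_const_mul] at key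
  have hg4 : g * δ ≤ 4 * C * ε := by
    have h1 : a ^ (γ - 1) ≤ 2 * C := by
      calc a ^ (γ - 1) ≤ (2 * C) ^ (γ - 1) := Real.rpow_le_rpow ha0.le ha2 (by linarith)
        _ ≤ (2 * C) ^ (1 : ℝ) :=
          Real.rpow_le_rpow_of_exponent_le (by linarith [S.one_le]) (by linarith)
        _ = 2 * C := Real.rpow_one _
    have h2 : g ≤ 2 * (2 * C) := mul_le_mul hγ₂.le h1 (Real.rpow_nonneg ha0.le _) (by norm_num)
    calc g * δ ≤ 2 * (2 * C) * ε := mul_le_mul h2 hδε hδ.le (by positivity)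
      _ = 4 * C * ε := by ring
  have hgδ : 0 ≤ g * δ := mul_nonneg (mul_nonneg (by linarith) (Real.rpow_nonneg ha0.le _)) hδ.le
  have hsplit : moll ε (fun z => r z ^ γ) z - a ^ γ =
      (avg (fun h => r (z - proj (ε • h)) ^ γ) - g * avg (fun h => r (z - proj (ε • h))) -
        (a ^ γ - g * a)) - g * δ := by
    have : avg (fun h => r (z - proj (ε • h))) = a - δ := by rw [ha, add_sub_cancel_right]; rfl
    rw [this]
    change avg (fun h => r (z - proj (ε • h)) ^ γ) - a ^ γ = _
    ring
  rw [hsplit]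
  refine (abs_sub _ _).trans ?_
  rw [abs_of_nonneg hgδ]
  linarith

end estimates

end HolderState

/-! ### Decay of the error with the mollification scale -/

namespace HolderState

section error

variable {T α β γ C : ℝ} {r : SpaceTime → ℝ} {w : Fin 3 → SpaceTime → ℝ}
  {R ε δ s : ℝ} {z : SpaceTime}

lemma abs_momentumResidual_le (S : HolderState T α β C r w) (hα : 0 ≤ α) (hα1 : α ≤ 1)
    (hβ : 0 ≤ β) (hγ₁ : 1 < γ) (hγ₂ : γ < 2) (hz : z ∈ slab T R) (hε : 0 < ε) (hε1 : ε ≤ 1)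
    (hεR : ε < R) (hδ : 0 < δ) (hδε : δ ≤ ε) (i : Fin 3) (k : Option (Fin 3)) :
    |momentumResidual γ (fun i k => moll ε (momFlux γ r w i k))
      (fun k => moll ε fun z => r z * fourVel w k z) (fun k => moll ε (fourVel w k))
      (fun z => moll ε r z + δ) i k z| ≤
      2 * C ^ 2 * ε ^ α * ε ^ β + (18 * C ^ 2 * (ε ^ α) ^ γ + 4 * C * ε) := by
  have hC := zero_le_one.trans S.one_le
  have h1 := S.abs_momentum_commutator_le hα hβ hz hε hεR i k
  have h2 := S.abs_pressure_commutator_le hα hα1 hγ₁ hγ₂ hz hε hε1 hεR hδ hδε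
  by_cases hk : k = some i
  · have h3 : moll ε (momFlux γ r w i k) z = moll ε (fun z => r z * fourVel w k z * w i z) z +
        moll ε (fun z => r z ^ γ) z := by
      have hb1 := ((S.bddMeas_flux k).mul (S.bddMeas_fourVel (some i))).shift ε z
      have hb2 := (S.bddMeas_pressure (γ := γ) (by linarith)).shift ε z
      have := avg_sub hb1 ((BddMeas.const (-1)).mul hb2)
      rw [avg_const_mul] at this
      simpa [moll, momFlux, hk, fourVel] using this
    simp only [momentumResidual, h3]
    rw [if_pos hk]
    refine le_trans (le_of_eq ?_) ((abs_add_le _ _).trans (add_le_add h1 h2))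
    congr 1
    simp only [fourVel]
    ring
  · have h3 : moll ε (momFlux γ r w i k) z =
        moll ε (fun z => r z * fourVel w k z * w i z) z := by
      simp [moll, momFlux, hk]
    simp only [momentumResidual, h3]
    rw [if_neg hk, sub_zero]
    exact h1.trans (le_add_of_nonneg_right (by positivity))

lemma abs_momentumResidual_mul_le (S : HolderState T α β C r w) (hα : 0 ≤ α) (hα1 : α ≤ 1)
    (hβ : 0 ≤ β) (hγ₁ : 1 < γ) (hγ₂ : γ < 2) (hz : z ∈ slab T R) (hε : 0 < ε) (hε1 : ε ≤ 1)
    (hεR : ε < R) (hδ : 0 < δ) (hδε : δ ≤ ε)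
    (hsα : s ≤ α) (hsβ : s ≤ β) (hs₁ : s ≤ γ * α + β - 1) (hs₂ : s ≤ α + 2 * β - 1)
    {φ : SpaceTime → ℝ} (hφ : Smooth φ) {Φ Λ : ℝ} (hΦ : |φ z| ≤ Φ)
    (hdΦ : ∀ k, |dirDeriv (axis k) φ z| ≤ Φ) (hΛ : ∀ k, kernelVar (axis k) ≤ Λ)
    (i : Fin 3) (k : Option (Fin 3)) :
    |momentumResidual γ (fun i k => moll ε (momFlux γ r w i k))
      (fun k => moll ε fun z => r z * fourVel w k z) (fun k => moll ε (fourVel w k))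
      (fun z => moll ε r z + δ) i k z *
      dirDeriv (axis k) (fun z => φ z * moll ε (fourVel w (some i)) z) z| ≤
      24 * C ^ 3 * Φ * (1 + Λ) * ε ^ s := by
  have hC := zero_le_one.trans S.one_le
  have hΦ0 : 0 ≤ Φ := (abs_nonneg _).trans hΦ
  have hΛ0 : 0 ≤ Λ := (kernelVar_nonneg _).trans (hΛ none)
  have pow_le : ∀ t, s ≤ t → ε ^ t ≤ ε ^ s := fun t ht =>
    Real.rpow_le_rpow_of_exponent_ge hε hε1 ht
  have f1 : ε ^ α * ε ^ β ≤ ε ^ s := by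
    rw [← Real.rpow_add hε]; exact pow_le _ (by linarith)
  have f2 : (ε ^ α) ^ γ ≤ ε ^ s := by
    rw [← Real.rpow_mul hε.le]; exact pow_le _ (by nlinarith)
  have f3 : ε ≤ ε ^ s := by simpa using pow_le 1 (by linarith)
  have f4 : ε ^ α * ε ^ β * (ε⁻¹ * ε ^ β) ≤ ε ^ s := by
    rw [← Real.rpow_neg_one, ← Real.rpow_add hε, ← Real.rpow_add hε, ← Real.rpow_add hε]
    exact pow_le _ (by linarith)
  have f5 : (ε ^ α) ^ γ * (ε⁻¹ * ε ^ β) ≤ ε ^ s := by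
    rw [← Real.rpow_mul hε.le, ← Real.rpow_neg_one, ← Real.rpow_add hε, ← Real.rpow_add hε]
    exact pow_le _ (by linarith)
  have f6 : ε * (ε⁻¹ * ε ^ β) ≤ ε ^ s := by
    rw [mul_inv_cancel_left₀ hε.ne']; exact pow_le _ hsβ
  have hres := S.abs_momentumResidual_le hα hα1 hβ hγ₁ hγ₂ hz hε hε1 hεR hδ hδε i k
  have hder : |dirDeriv (axis k) (fun z => φ z * moll ε (fourVel w (some i)) z) z| ≤
      Φ * C * 1 + Φ * C * Λ * (ε⁻¹ * ε ^ β) := by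
    rw [hφ.dirDeriv_mul (smooth_moll hε.ne' (S.bddMeas_fourVel _))]
    refine (abs_add_le _ _).trans (add_le_add ?_ ?_)
    · rw [abs_mul, mul_one]
      exact mul_le_mul (hdΦ k) (S.abs_moll_fourVel_le ε _ z) (abs_nonneg _) hΦ0
    · have h1 := S.abs_dirDeriv_moll_fourVel_le hβ hz hε hεR (some i) (axis k)
      rw [abs_mul]
      calc _ ≤ Φ * (Λ * (ε⁻¹ * (C * ε ^ β))) := by
            refine mul_le_mul hΦ (h1.trans ?_) (abs_nonneg _) hΦ0
            exact mul_le_mul_of_nonneg_right (hΛ k) (by positivity)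
        _ = _ := by ring
  have hA : ∀ {x y t e : ℝ}, x ≤ e → y ≤ e → t ≤ e → 0 ≤ e →
      2 * C ^ 2 * x + (18 * C ^ 2 * y + 4 * C * t) ≤ 24 * C ^ 2 * e := by
    intro x y t e hx hy ht he
    have hCC : C ≤ C ^ 2 := by nlinarith [S.one_le]
    have h1 := mul_le_mul_of_nonneg_left hx (sq_nonneg C)
    have h2 := mul_le_mul_of_nonneg_left hy (sq_nonneg C)
    have h3 := mul_le_mul_of_nonneg_left ht hC
    have h4 := mul_le_mul_of_nonneg_right hCC he
    linarith
  have he : 0 ≤ ε ^ s := Real.rpow_nonneg hε.le s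
  have a1 := hA f1 f2 f3 he
  have a2 := hA f4 f5 f6 he
  rw [abs_mul]
  calc _ ≤ (2 * C ^ 2 * ε ^ α * ε ^ β + (18 * C ^ 2 * (ε ^ α) ^ γ + 4 * C * ε)) *
        (Φ * C * 1 + Φ * C * Λ * (ε⁻¹ * ε ^ β)) :=
        mul_le_mul hres hder (abs_nonneg _) (by positivity)
    _ = Φ * C * (2 * C ^ 2 * (ε ^ α * ε ^ β) + (18 * C ^ 2 * (ε ^ α) ^ γ + 4 * C * ε)) +
        Φ * C * Λ * (2 * C ^ 2 * (ε ^ α * ε ^ β * (ε⁻¹ * ε ^ β)) +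
          (18 * C ^ 2 * ((ε ^ α) ^ γ * (ε⁻¹ * ε ^ β)) + 4 * C * (ε * (ε⁻¹ * ε ^ β)))) := by ring
    _ ≤ Φ * C * (24 * C ^ 2 * ε ^ s) + Φ * C * Λ * (24 * C ^ 2 * ε ^ s) := by
        gcongr
    _ = _ := by ring

/-- The mass residual is of order `ε ^ β min (σ, ε ^ α)`, up to the shift `δ`; this compensates the
singular factor `σ ^ (γ - 2)` which the derivative of `σ ^ (γ - 1)` produces near the vacuum. -/
lemma abs_massResidual_mul_le (S : HolderState T α β C r w) (hα : 0 ≤ α) (hα1 : α ≤ 1)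
    (hβ : 0 ≤ β) (hγ₁ : 1 < γ) (hγ₂ : γ < 2) (hz : z ∈ slab T R) (hε : 0 < ε) (hε1 : ε ≤ 1)
    (hεR : ε < R) (hδ : 0 < δ) (hδε : δ ≤ ε) (hδγ : δ ^ (γ - 1) ≤ ε)
    (hsα : s ≤ α) (hs₁ : s ≤ γ * α + β - 1)
    {φ : SpaceTime → ℝ} (hφ : Smooth φ) {Φ Λ : ℝ} (hΦ : |φ z| ≤ Φ)
    (hdΦ : ∀ k, |dirDeriv (axis k) φ z| ≤ Φ) (hΛ : ∀ k, kernelVar (axis k) ≤ Λ)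
    (k : Option (Fin 3)) :
    |((moll ε r z + δ) * moll ε (fourVel w k) z - moll ε (fun z => r z * fourVel w k z) z) *
      dirDeriv (axis k) (fun z => φ z * (moll ε r z + δ) ^ (γ - 1)) z| ≤
      24 * C ^ 3 * Φ * (1 + Λ) * ε ^ s := by
  have hC := zero_le_one.trans S.one_le
  have hΦ0 : 0 ≤ Φ := (abs_nonneg _).trans hΦ
  have hΛ0 : 0 ≤ Λ := (kernelVar_nonneg _).trans (hΛ none)
  have pow_le : ∀ t, s ≤ t → ε ^ t ≤ ε ^ s := fun t ht =>
    Real.rpow_le_rpow_of_exponent_ge hε hε1 ht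
  have f1 : ε ^ β * ε ^ α ≤ ε ^ s := by
    rw [← Real.rpow_add hε]; exact pow_le _ (by linarith)
  have f3 : ε ≤ ε ^ s := by simpa using pow_le 1 (by linarith)
  have f4 : ε ^ β * (ε ^ α) ^ (γ - 1) * (ε⁻¹ * ε ^ α) ≤ ε ^ s := by
    rw [← Real.rpow_mul hε.le, ← Real.rpow_neg_one, ← Real.rpow_add hε, ← Real.rpow_add hε,
      ← Real.rpow_add hε]
    exact pow_le _ (by linarith)
  have f5 : ε * (ε⁻¹ * ε ^ α) ≤ ε ^ s := by
    rw [mul_inv_cancel_left₀ hε.ne']; exact pow_le _ hsα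
  have he : 0 ≤ ε ^ s := Real.rpow_nonneg hε.le s
  have hpos : ∀ z, 0 < moll ε r z + δ := fun z =>
    add_pos_of_nonneg_of_pos (S.moll_dens_nonneg ε z) hδ
  have hσs : Smooth fun z => moll ε r z + δ :=
    (smooth_moll hε.ne' S.bddMeas_dens).add (Smooth.const δ)
  have hdσ : |dirDeriv (axis k) (fun z => moll ε r z + δ) z| ≤ C * Λ * (ε⁻¹ * ε ^ α) := by
    rw [Smooth.dirDeriv_add_const]
    refine (S.abs_dirDeriv_moll_dens_le hα hz hε hεR (axis k)).trans ?_
    calc _ ≤ Λ * (ε⁻¹ * (C * ε ^ α)) := mul_le_mul_of_nonneg_right (hΛ k) (by positivity)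
      _ = _ := by ring
  have hcom := S.abs_mass_commutator_le hα hβ hz hε hεR k
  have hW := S.abs_moll_fourVel_le ε k z
  have hρC := S.moll_dens_le ε z
  have hρ0 := S.moll_dens_nonneg ε z
  rw [hφ.dirDeriv_mul (hσs.rpow hpos _), hσs.dirDeriv_rpow hpos]
  have hσ := hpos z
  set ρ := moll ε r z with hρ
  set σ := ρ + δ with hσdef
  set M := σ * moll ε (fourVel w k) z - moll ε (fun z => r z * fourVel w k z) z with hMdef
  have hM : |M| ≤ 2 * C ^ 2 * ε ^ β * min ρ (ε ^ α) + C * δ := by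
    have h1 : M = δ * moll ε (fourVel w k) z -
        (moll ε (fun z => r z * fourVel w k z) z - ρ * moll ε (fourVel w k) z) := by
      rw [hMdef, hσdef]; ring
    rw [h1]
    refine (abs_sub _ _).trans ?_
    rw [abs_mul, abs_of_pos hδ]
    nlinarith
  have hM1 : |M| ≤ 3 * C ^ 2 * ε ^ s := by
    have h1 : ε ^ β * min ρ (ε ^ α) ≤ ε ^ s :=
      (mul_le_mul_of_nonneg_left (min_le_right _ _) (by positivity)).trans f1
    have h2 : C * δ ≤ C ^ 2 * ε ^ s :=
      mul_le_mul (by nlinarith [S.one_le]) (hδε.trans f3) hδ.le (by positivity)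
    nlinarith [mul_le_mul_of_nonneg_left h1 (sq_nonneg C)]
  have hM2 : |M| * σ ^ (γ - 1 - 1) ≤ 2 * C ^ 2 * (ε ^ β * (ε ^ α) ^ (γ - 1)) + C * ε := by
    have h1 : min ρ (ε ^ α) * σ ^ (γ - 1 - 1) ≤ (ε ^ α) ^ (γ - 1) :=
      min_mul_rpow_le hσ (by positivity) hγ₁ hγ₂ ((min_le_left _ _).trans (by linarith))
        (min_le_right _ _)
    have h2 : δ * σ ^ (γ - 1 - 1) ≤ ε :=
      (min_mul_rpow_le hσ hδ hγ₁ hγ₂ (by linarith) le_rfl).trans hδγ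
    calc |M| * σ ^ (γ - 1 - 1)
        ≤ (2 * C ^ 2 * ε ^ β * min ρ (ε ^ α) + C * δ) * σ ^ (γ - 1 - 1) :=
          mul_le_mul_of_nonneg_right hM (Real.rpow_nonneg hσ.le _)
      _ = 2 * C ^ 2 * (ε ^ β * (min ρ (ε ^ α) * σ ^ (γ - 1 - 1))) +
          C * (δ * σ ^ (γ - 1 - 1)) := by ring
      _ ≤ _ := by gcongr
  have hσg : σ ^ (γ - 1) ≤ 2 * C := by
    calc σ ^ (γ - 1) ≤ (2 * C) ^ (γ - 1) :=
          Real.rpow_le_rpow hσ.le (by linarith [S.one_le]) (by linarith)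
      _ ≤ (2 * C) ^ (1 : ℝ) :=
        Real.rpow_le_rpow_of_exponent_le (by linarith [S.one_le]) (by linarith)
      _ = 2 * C := Real.rpow_one _
  have t1 : |M * (dirDeriv (axis k) φ z * σ ^ (γ - 1))| ≤ 6 * C ^ 3 * Φ * ε ^ s := by
    rw [abs_mul, abs_mul, abs_of_nonneg (Real.rpow_nonneg hσ.le _)]
    calc _ ≤ (3 * C ^ 2 * ε ^ s) * (Φ * (2 * C)) := by
          gcongr
          exact hdΦ k
      _ = _ := by ring
  have t2 : |M * (φ z * (dirDeriv (axis k) (fun z => moll ε r z + δ) z * (γ - 1) *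
      σ ^ (γ - 1 - 1)))| ≤ 3 * C ^ 3 * Φ * Λ * ε ^ s := by
    have h1 : |M * (φ z * (dirDeriv (axis k) (fun z => moll ε r z + δ) z * (γ - 1) *
        σ ^ (γ - 1 - 1)))| = |φ z| * (γ - 1) * (|M| * σ ^ (γ - 1 - 1) *
        |dirDeriv (axis k) (fun z => moll ε r z + δ) z|) := by
      simp only [abs_mul, abs_of_nonneg (Real.rpow_nonneg hσ.le (γ - 1 - 1)),
        abs_of_pos (sub_pos.2 hγ₁)]
      ring
    have h2 : C * (ε * (ε⁻¹ * ε ^ α)) ≤ C ^ 2 * ε ^ s :=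
      mul_le_mul (by nlinarith [S.one_le]) f5 (by positivity) (by positivity)
    rw [h1]
    calc _ ≤ Φ * 1 * ((2 * C ^ 2 * (ε ^ β * (ε ^ α) ^ (γ - 1)) + C * ε) *
          (C * Λ * (ε⁻¹ * ε ^ α))) := by
          refine mul_le_mul (mul_le_mul hΦ (by linarith) (by linarith) hΦ0)
            (mul_le_mul hM2 hdσ (abs_nonneg _) (by positivity))
            (mul_nonneg (mul_nonneg (abs_nonneg _) (Real.rpow_nonneg hσ.le _)) (abs_nonneg _))
            (by linarith)
      _ = Φ * (C * Λ) * (2 * C ^ 2 * (ε ^ β * (ε ^ α) ^ (γ - 1) * (ε⁻¹ * ε ^ α)) +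
          C * (ε * (ε⁻¹ * ε ^ α))) := by ring
      _ ≤ Φ * (C * Λ) * (2 * C ^ 2 * ε ^ s + C ^ 2 * ε ^ s) := by gcongr
      _ = _ := by ring
  rw [mul_add]
  refine (abs_add_le _ _).trans ((add_le_add t1 t2).trans ?_)
  have n1 : 0 ≤ C ^ 3 * Φ * ε ^ s := by positivity
  have n2 : 0 ≤ C ^ 3 * Φ * Λ * ε ^ s := by positivity
  nlinarith

lemma abs_energyError_le (S : HolderState T α β C r w) (hα : 0 ≤ α) (hα1 : α ≤ 1)
    (hβ : 0 ≤ β) (hγ₁ : 1 < γ) (hγ₂ : γ < 2) (hz : z ∈ slab T R) (hε : 0 < ε) (hε1 : ε ≤ 1)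
    (hεR : ε < R) (hδ : 0 < δ) (hδε : δ ≤ ε) (hδγ : δ ^ (γ - 1) ≤ ε)
    (hsα : s ≤ α) (hsβ : s ≤ β) (hs₁ : s ≤ γ * α + β - 1) (hs₂ : s ≤ α + 2 * β - 1)
    {φ : SpaceTime → ℝ} (hφ : Smooth φ) {Φ Λ : ℝ} (hΦ : |φ z| ≤ Φ)
    (hdΦ : ∀ k, |dirDeriv (axis k) φ z| ≤ Φ) (hΛ : ∀ k, kernelVar (axis k) ≤ Λ) :
    |energyError γ (fun i k => moll ε (momFlux γ r w i k))
      (fun k => moll ε fun z => r z * fourVel w k z) (fun k => moll ε (fourVel w k))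
      (fun z => moll ε r z + δ) φ z| ≤
      (γ / (γ - 1) * 4 + 12) * (24 * C ^ 3 * Φ * (1 + Λ) * ε ^ s) := by
  have h1 := fun k => S.abs_massResidual_mul_le hα hα1 hβ hγ₁ hγ₂ hz hε hε1 hεR hδ hδε hδγ hsα
    hs₁ hφ hΦ hdΦ hΛ k
  have h2 := fun i k => S.abs_momentumResidual_mul_le hα hα1 hβ hγ₁ hγ₂ hz hε hε1 hεR hδ hδε hsα
    hsβ hs₁ hs₂ hφ hΦ hdΦ hΛ i k
  have hc : 0 ≤ γ / (γ - 1) := div_nonneg (by linarith) (by linarith)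
  rw [energyError]
  refine (abs_sub _ _).trans ?_
  rw [abs_mul, abs_of_nonneg hc, add_mul, mul_assoc]
  refine add_le_add (mul_le_mul_of_nonneg_left ?_ hc) ?_
  · refine (Finset.abs_sum_le_sum_abs _ _).trans ((Finset.sum_le_sum fun k _ => h1 k).trans ?_)
    simp [Finset.sum_const]
  · refine (Finset.abs_sum_le_sum_abs _ _).trans ((Finset.sum_le_sum fun i _ =>
      (Finset.abs_sum_le_sum_abs _ _).trans (Finset.sum_le_sum fun k _ => h2 i k)).trans ?_)
    simp [Finset.sum_const]
    linarith

end error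

end HolderState

/-! ### Passage to the limit -/

lemma IsTestFunction.isSmooth {T : ℝ} {φ : SpaceTime → ℝ} (h : IsTestFunction T φ) : Smooth φ :=
  h.smooth

lemma IsTestFunction.exists_slab {T : ℝ} {φ : SpaceTime → ℝ} (h : IsTestFunction T φ) :
    ∃ R, 0 < R ∧ tsupport φ ⊆ slab T R := by
  have hcont : Continuous fun z : SpaceTime => min z.2 (T - z.2) := by fun_prop
  obtain ⟨R, hR, hle⟩ := h.hasCompactSupport.isCompact.exists_forall_le' hcont.continuousOn
    (a := 0) fun z hz => lt_min (h.tsupport_subset hz).2.1 (sub_pos.2 (h.tsupport_subset hz).2.2)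
  exact ⟨R, hR, fun z hz => ⟨mem_univ _, (hle z hz).trans (min_le_left _ _), by
    linarith [(hle z hz).trans (min_le_right _ _)]⟩⟩

lemma IsTestFunction.exists_bound {T : ℝ} {φ : SpaceTime → ℝ} (h : IsTestFunction T φ) :
    ∃ Φ, (∀ z, |φ z| ≤ Φ) ∧ ∀ k z, |dirDeriv (axis k) φ z| ≤ Φ := by
  obtain ⟨A, hA⟩ := h.isSmooth.continuous.bounded_above_of_compact_support h.hasCompactSupport
  have h1 : ∀ k, ∃ B, ∀ z, ‖dirDeriv (axis k) φ z‖ ≤ B := fun k =>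
    (h.isSmooth.continuous_dirDeriv _).bounded_above_of_compact_support
      (h.hasCompactSupport.of_isClosed_subset (isClosed_tsupport _) (tsupport_dirDeriv_subset φ _))
  choose B hB using h1
  have hB0 : ∀ k, 0 ≤ B k := fun k => (norm_nonneg _).trans (hB k 0)
  have hA0 : 0 ≤ A := (norm_nonneg _).trans (hA 0)
  refine ⟨A + ∑ k, B k, fun z => (hA z).trans ?_, fun k z => (hB k z).trans ?_⟩
  · linarith [Finset.sum_nonneg fun k (_ : k ∈ Finset.univ) => hB0 k]
  · linarith [Finset.single_le_sum (fun k _ => hB0 k) (Finset.mem_univ k)]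

lemma energyPairing_eq_zero {γ : ℝ} {m W : Option (Fin 3) → SpaceTime → ℝ}
    {σ φ : SpaceTime → ℝ} {z : SpaceTime} (hz : z ∉ tsupport φ) :
    energyPairing γ m W σ φ z = 0 := by
  simp [energyPairing, dirDeriv_eq_zero hz]

lemma energyError_eq_zero {γ : ℝ} {N : Fin 3 → Option (Fin 3) → SpaceTime → ℝ}
    {m W : Option (Fin 3) → SpaceTime → ℝ} {σ φ : SpaceTime → ℝ} {z : SpaceTime}
    (hz : z ∉ tsupport φ) : energyError γ N m W σ φ z = 0 := by
  have h : ∀ (g : SpaceTime → ℝ) v, dirDeriv v (fun z => φ z * g z) z = 0 := fun g v =>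
    dirDeriv_eq_zero (fun hz' => hz (tsupport_mul_subset_left hz')) v
  simp only [energyError, h]
  simp

lemma abs_energyPairing_le {γ C Φ : ℝ} {m W : Option (Fin 3) → SpaceTime → ℝ}
    {σ φ : SpaceTime → ℝ} {z : SpaceTime} (hγ : 1 < γ) (hC : 0 ≤ C) (hm : ∀ k, |m k z| ≤ C)
    (hW : ∀ k, |W k z| ≤ C) (hσ0 : 0 ≤ σ z) (hσ : σ z ≤ C)
    (hΦ : ∀ k, |dirDeriv (axis k) φ z| ≤ Φ) :
    |energyPairing γ m W σ φ z| ≤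
      4 * ((1 / 2 * C * (3 * C ^ 2) + C ^ γ / (γ - 1) * C) * Φ) + 3 * (C ^ γ * C * Φ) := by
  have hΦ0 : 0 ≤ Φ := (abs_nonneg _).trans (hΦ none)
  have hγ' : 0 < γ - 1 := sub_pos.2 hγ
  have hp : |σ z ^ γ| ≤ C ^ γ := by
    rw [abs_of_nonneg (Real.rpow_nonneg hσ0 _)]
    exact Real.rpow_le_rpow hσ0 hσ (by linarith)
  have hsq : |∑ i : Fin 3, W (some i) z ^ 2| ≤ 3 * C ^ 2 := by
    refine (Finset.abs_sum_le_sum_abs _ _).trans ((Finset.sum_le_sum (g := fun _ => C ^ 2)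
      fun i _ => ?_).trans (by simp))
    rw [abs_pow]
    exact pow_le_pow_left₀ (abs_nonneg _) (hW _) 2
  refine (abs_add_le _ _).trans (add_le_add ?_ ?_)
  · refine (Finset.abs_sum_le_sum_abs _ _).trans ((Finset.sum_le_sum
      (g := fun _ => (1 / 2 * C * (3 * C ^ 2) + C ^ γ / (γ - 1) * C) * Φ)
      fun k _ => ?_).trans (by simp))
    rw [abs_mul]
    refine mul_le_mul ((abs_add_le _ _).trans (add_le_add ?_ ?_)) (hΦ k) (abs_nonneg _)
      (by positivity)
    · rw [abs_mul, abs_mul, abs_of_nonneg (by norm_num : (0 : ℝ) ≤ 1 / 2)]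
      gcongr
      exact hm k
    · rw [abs_mul, abs_div, abs_of_pos hγ']
      gcongr
      exact hW k
  · refine (Finset.abs_sum_le_sum_abs _ _).trans ((Finset.sum_le_sum
      (g := fun _ => C ^ γ * C * Φ) fun i _ => ?_).trans (by simp))
    rw [abs_mul, abs_mul]
    gcongr
    · exact hW _
    · exact hΦ _

lemma tendsto_moll {T R a C : ℝ} {f : SpaceTime → ℝ} (hb : BddMeas f) (hC : 0 ≤ C) (ha : 0 < a)
    (hf : ∀ x ∈ cylinder T, ∀ y ∈ cylinder T, |f x - f y| ≤ C * dist x y ^ a)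
    {z : SpaceTime} (hR : 0 < R) (hz : z ∈ slab T R) :
    Filter.Tendsto (fun ε => moll ε f z) (nhdsWithin 0 (Ioi 0)) (nhds (f z)) := by
  rw [tendsto_iff_dist_tendsto_zero]
  have h0 : Filter.Tendsto (fun ε : ℝ => C * ε ^ a) (nhdsWithin 0 (Ioi 0)) (nhds 0) := by
    have := ((Real.continuousAt_rpow_const 0 a (Or.inr ha.le)).tendsto.const_mul C)
    rw [Real.zero_rpow ha.ne', mul_zero] at this
    exact this.mono_left nhdsWithin_le_nhds
  refine squeeze_zero' (Filter.Eventually.of_forall fun _ => dist_nonneg) ?_ h0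
  filter_upwards [Ioo_mem_nhdsGT hR] with ε hε
  exact abs_avg_sub_le (hb.shift ε z) fun h hh => abs_shift_sub_le hC ha.le hf hz hε.1 hε.2 hh.le

/-- A bounded weak solution with Hölder regularity on the cylinder conserves energy locally. -/
theorem HolderState.integral_energyPairing_eq_zero {T α β γ C : ℝ} {r : SpaceTime → ℝ}
    {w : Fin 3 → SpaceTime → ℝ} (S : HolderState T α β C r w) (hα : 0 < α) (hα1 : α ≤ 1)
    (hβ : 0 < β) (hγ₁ : 1 < γ) (hγ₂ : γ < 2) (hαβ₁ : 1 < γ * α + β) (hαβ₂ : 1 < α + 2 * β)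
    (hmass : ∀ ψ, IsTestFunction T ψ →
      ∑ k, ∫ z, r z * fourVel w k z * dirDeriv (axis k) ψ z = 0)
    (hmom : ∀ i ψ, IsTestFunction T ψ →
      ∑ k, ∫ z, momFlux γ r w i k z * dirDeriv (axis k) ψ z = 0)
    {φ : SpaceTime → ℝ} (hφ : IsTestFunction T φ) :
    ∫ z, energyPairing γ (fun k z => r z * fourVel w k z) (fourVel w) r φ z = 0 := by
  obtain ⟨R, hR, hslab⟩ := hφ.exists_slab
  obtain ⟨Φ, hΦ, hdΦ⟩ := hφ.exists_bound
  have hC := zero_le_one.trans S.one_le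
  -- the shift `δ` is chosen so small that `δ ^ (γ - 1) = ε`
  set δ : ℝ → ℝ := fun ε => ε ^ (γ - 1)⁻¹ with hδ
  have hγ' : 0 < γ - 1 := sub_pos.2 hγ₁
  have hδ1 : ∀ ε, 0 < ε → ε ≤ 1 → δ ε ≤ ε := fun ε h0 h1 => by
    simpa using Real.rpow_le_rpow_of_exponent_ge h0 h1
      ((one_le_inv₀ hγ').2 (by linarith) : 1 ≤ (γ - 1)⁻¹)
  have hδ2 : ∀ ε, 0 < ε → δ ε ^ (γ - 1) ≤ ε := fun ε h0 => by
    rw [hδ, Real.rpow_inv_rpow h0.le hγ'.ne']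
  set m := fun (ε : ℝ) (k : Option (Fin 3)) => moll ε fun z => r z * fourVel w k z with hm
  set W := fun (ε : ℝ) (k : Option (Fin 3)) => moll ε (fourVel w k) with hW
  set σ := fun (ε : ℝ) (z : SpaceTime) => moll ε r z + δ ε with hσ
  set N := fun (ε : ℝ) i k => moll ε (momFlux γ r w i k) with hN
  have hsmall : ∀ᶠ ε in nhdsWithin (0 : ℝ) (Ioi 0), 0 < ε ∧ ε ≤ 1 ∧ ε < R := by
    filter_upwards [Ioo_mem_nhdsGT (lt_min one_pos hR)] with ε hε
    exact ⟨hε.1, (hε.2.trans_le (min_le_left _ _)).le, hε.2.trans_le (min_le_right _ _)⟩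
  have hpos : ∀ ε, 0 < ε → ∀ z, 0 < σ ε z := fun ε h0 z =>
    add_pos_of_nonneg_of_pos (S.moll_dens_nonneg ε z) (Real.rpow_pos_of_pos h0 _)
  -- the identity at scale `ε`
  have hid : ∀ᶠ ε in nhdsWithin (0 : ℝ) (Ioi 0), ∫ z, energyPairing γ (m ε) (W ε) (σ ε) φ z =
      ∫ z, energyError γ (N ε) (m ε) (W ε) (σ ε) φ z := by
    filter_upwards [hsmall] with ε ⟨h0, h1, h2⟩
    have hbm := S.bddMeas_momFlux (γ := γ) (by linarith)
    refine integral_energyPairing_eq hγ'.ne'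
      (fun i k => (smooth_moll h0.ne' (hbm i k)).continuous)
      (fun k => (smooth_moll h0.ne' (S.bddMeas_flux k)).continuous)
      (fun k => smooth_moll h0.ne' (S.bddMeas_fourVel k)) (moll_const ε 1)
      ((smooth_moll h0.ne' S.bddMeas_dens).add (Smooth.const _)) (hpos ε h0) hφ.isSmooth
      hφ.hasCompactSupport (fun ψ hψ hs => ?_) (fun i ψ hψ hs => ?_)
    · exact sum_integral_moll_mul_dirDeriv (fun k => S.bddMeas_flux k) hmass hψ
        (hφ.hasCompactSupport.of_isClosed_subset (isClosed_tsupport _) hs) (hs.trans hslab) h0 h2.le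
    · exact sum_integral_moll_mul_dirDeriv (fun k => hbm i k) (hmom i) hψ
        (hφ.hasCompactSupport.of_isClosed_subset (isClosed_tsupport _) hs) (hs.trans hslab) h0 h2.le
  -- the error tends to zero
  have herr : Filter.Tendsto (fun ε => ∫ z, energyError γ (N ε) (m ε) (W ε) (σ ε) φ z)
      (nhdsWithin (0 : ℝ) (Ioi 0)) (nhds 0) := by
    obtain ⟨s, hs0, hsα, hsβ, hs₁, hs₂⟩ : ∃ s : ℝ, 0 < s ∧ s ≤ α ∧ s ≤ β ∧
        s ≤ γ * α + β - 1 ∧ s ≤ α + 2 * β - 1 :=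
      ⟨min (min α β) (min (γ * α + β - 1) (α + 2 * β - 1)),
        lt_min (lt_min hα hβ) (lt_min (by linarith) (by linarith)),
        (min_le_left _ _).trans (min_le_left _ _), (min_le_left _ _).trans (min_le_right _ _),
        (min_le_right _ _).trans (min_le_left _ _), (min_le_right _ _).trans (min_le_right _ _)⟩
    set Λ := ∑ k, kernelVar (axis k)
    have hΛ : ∀ k, kernelVar (axis k) ≤ Λ := fun k =>
      Finset.single_le_sum (f := fun k => kernelVar (axis k)) (fun k _ => kernelVar_nonneg _)
        (Finset.mem_univ k)
    have h0 : Filter.Tendsto (fun ε : ℝ => (γ / (γ - 1) * 4 + 12) * (24 * C ^ 3 * Φ * (1 + Λ) *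
        ε ^ s) * volume.real (tsupport φ)) (nhdsWithin 0 (Ioi 0)) (nhds 0) := by
      have h1 : Filter.Tendsto (fun ε : ℝ => ε ^ s) (nhdsWithin 0 (Ioi 0)) (nhds 0) := by
        have := (Real.continuousAt_rpow_const 0 s (Or.inr hs0.le)).tendsto
        rw [Real.zero_rpow hs0.ne'] at this
        exact this.mono_left nhdsWithin_le_nhds
      simpa using ((h1.const_mul (24 * C ^ 3 * Φ * (1 + Λ))).const_mul
        (γ / (γ - 1) * 4 + 12)).mul_const (volume.real (tsupport φ))
    refine squeeze_zero_norm' ?_ h0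
    filter_upwards [hsmall] with ε ⟨e0, e1, e2⟩
    rw [← setIntegral_eq_integral_of_forall_compl_eq_zero (s := tsupport φ)
      fun z hz => energyError_eq_zero hz]
    refine norm_setIntegral_le_of_norm_le_const hφ.hasCompactSupport.isCompact.measure_lt_top
      fun z hz => ?_
    exact S.abs_energyError_le hα.le hα1 hβ.le hγ₁ hγ₂ (hslab hz) e0 e1 e2
      (Real.rpow_pos_of_pos e0 _) (hδ1 ε e0 e1) (hδ2 ε e0) hsα hsβ hs₁ hs₂ hφ.isSmooth (hΦ z)
      (fun k => hdΦ k z) hΛ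
  -- the mollified pairing tends to the pairing
  have hlim : Filter.Tendsto (fun ε => ∫ z, energyPairing γ (m ε) (W ε) (σ ε) φ z)
      (nhdsWithin (0 : ℝ) (Ioi 0))
      (nhds (∫ z, energyPairing γ (fun k z => r z * fourVel w k z) (fourVel w) r φ z)) := by
    set B := 2 * C ^ 2 with hB
    have hCB : C ≤ B := by nlinarith [S.one_le]
    refine tendsto_integral_filter_of_dominated_convergence ((tsupport φ).indicator fun _ =>
      4 * ((1 / 2 * B * (3 * B ^ 2) + B ^ γ / (γ - 1) * B) * Φ) + 3 * (B ^ γ * B * Φ)) ?_ ?_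
      ((integrable_indicator_iff (isClosed_tsupport φ).measurableSet).2
        (integrableOn_const hφ.hasCompactSupport.isCompact.measure_lt_top.ne)) ?_
    · filter_upwards [hsmall] with ε ⟨e0, _, _⟩
      have c1 : ∀ k, Continuous (m ε k) := fun k =>
        (smooth_moll e0.ne' (S.bddMeas_flux k)).continuous
      have c2 : ∀ k, Continuous (W ε k) := fun k =>
        (smooth_moll e0.ne' (S.bddMeas_fourVel k)).continuous
      have c3 : Continuous fun z => σ ε z ^ γ :=
        (((smooth_moll e0.ne' S.bddMeas_dens).add (Smooth.const _)).rpow (hpos ε e0) γ).continuous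
      have c4 : ∀ k, Continuous (dirDeriv (axis k) φ) := fun k => hφ.isSmooth.continuous_dirDeriv _
      refine Continuous.aestronglyMeasurable ?_
      refine Continuous.add (continuous_finsetSum _ fun k _ => ?_)
        (continuous_finsetSum _ fun i _ => ?_)
      · have := c1 k
        have := c4 k
        fun_prop
      · have := c4 (some i)
        fun_prop
    · filter_upwards [hsmall] with ε ⟨e0, e1, e2⟩
      refine Filter.Eventually.of_forall fun z => ?_
      by_cases hz : z ∈ tsupport φ
      · rw [indicator_of_mem hz, Real.norm_eq_abs]
        refine abs_energyPairing_le hγ₁ (hC.trans hCB) (fun k => ?_)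
          (fun k => (S.abs_moll_fourVel_le ε k z).trans hCB) (hpos ε e0 z).le ?_
          (fun k => hdΦ k z)
        · refine (abs_avg_le_avg ((S.bddMeas_flux k).shift ε z) (.const B) fun h _ => ?_).trans
            (avg_const B).le
          rw [abs_mul, abs_of_nonneg (S.nonneg _)]
          nlinarith [mul_le_mul (S.dens_le (z - proj (ε • h))) (S.fourVel_le k (z - proj (ε • h)))
            (abs_nonneg _) hC]
        · have := hδ1 ε e0 e1
          have := S.moll_dens_le ε z
          have := S.one_le
          simp only [hσ, hB]
          nlinarith
      · simp [hz, energyPairing_eq_zero hz]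
    · refine Filter.Eventually.of_forall fun z => ?_
      by_cases hz : z ∈ tsupport φ
      · have hzs := hslab hz
        have l1 : ∀ k, Filter.Tendsto (fun ε => m ε k z) (nhdsWithin 0 (Ioi 0))
            (nhds (r z * fourVel w k z)) := fun k =>
          tendsto_moll (S.bddMeas_flux k) hC hα (S.flux_holder k) hR hzs
        have l2 : ∀ k, Filter.Tendsto (fun ε => W ε k z) (nhdsWithin 0 (Ioi 0))
            (nhds (fourVel w k z)) := fun k =>
          tendsto_moll (S.bddMeas_fourVel k) hC hβ (S.fourVel_holder k) hR hzs
        have l3 : Filter.Tendsto (fun ε => σ ε z) (nhdsWithin 0 (Ioi 0)) (nhds (r z)) := by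
          have h1 := (Real.continuousAt_rpow_const 0 (γ - 1)⁻¹
            (Or.inr (inv_pos.2 hγ').le)).tendsto
          rw [Real.zero_rpow (inv_pos.2 hγ').ne'] at h1
          simpa using (tendsto_moll S.bddMeas_dens hC hα S.dens_holder hR hzs).add
            (h1.mono_left nhdsWithin_le_nhds)
        have l4 : Filter.Tendsto (fun ε => σ ε z ^ γ) (nhdsWithin 0 (Ioi 0))
            (nhds (r z ^ γ)) := l3.rpow_const (Or.inr (by linarith))
        refine Filter.Tendsto.add (tendsto_finsetSum _ fun k _ => ?_)
          (tendsto_finsetSum _ fun i _ => ?_)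
        · exact ((((l1 k).const_mul _).mul (tendsto_finsetSum _ fun i _ => (l2 _).pow 2)).add
            ((l4.div_const _).mul (l2 k))).mul_const _
        · exact (l4.mul (l2 _)).mul_const _
      · simp [energyPairing_eq_zero hz]
  exact tendsto_nhds_unique hlim (herr.congr' (hid.mono fun _ h => h.symm))

/-! ### Local energy conservation -/

lemma isOpen_cylinder (T : ℝ) : IsOpen (cylinder T) := isOpen_univ.prod isOpen_Ioo

lemma measurableSet_cylinder (T : ℝ) : MeasurableSet (cylinder T) :=
  (isOpen_cylinder T).measurableSet

lemma isBounded_cylinder (T : ℝ) : Bornology.IsBounded (cylinder T) :=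
  (isCompact_univ.prod isCompact_Icc).isBounded.subset
    (prod_mono Subset.rfl (Ioo_subset_Icc_self (a := 0) (b := T)))

lemma MemHolderSpace.exists_bound {E : Type*} [SeminormedAddCommGroup E] {T : ℝ} {a : ℝ≥0}
    {f : SpaceTime → E} (h : MemHolderSpace T a f) :
    ∃ C : ℝ, (∀ x ∈ cylinder T, ∀ y ∈ cylinder T, ‖f x - f y‖ ≤ C * dist x y ^ (a : ℝ)) ∧
      ∀ x ∈ cylinder T, ‖f x‖ ≤ C := by
  obtain ⟨C, hC⟩ := h
  obtain ⟨D, hD⟩ := Metric.isBounded_iff.1 (isBounded_cylinder T)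
  rcases (cylinder T).eq_empty_or_nonempty with he | ⟨z₀, hz₀⟩
  · simp [he]
  have hD0 : 0 ≤ D := dist_nonneg.trans (hD hz₀ hz₀)
  refine ⟨C + (C * D ^ (a : ℝ) + ‖f z₀‖), fun x hx y hy => ?_, fun x hx => ?_⟩
  · rw [← dist_eq_norm]
    refine (hC.dist_le hx hy).trans (mul_le_mul_of_nonneg_right ?_ (by positivity))
    exact le_add_of_nonneg_right (by positivity)
  · have h1 : ‖f x - f z₀‖ ≤ C * D ^ (a : ℝ) := by
      rw [← dist_eq_norm]
      refine (hC.dist_le hx hz₀).trans ?_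
      gcongr
      exact hD hx hz₀
    have h2 := norm_le_norm_sub_add (f x) (f z₀)
    have h3 := C.coe_nonneg
    linarith

lemma MemHolderSpace.continuousOn {E : Type*} [PseudoEMetricSpace E] {T : ℝ} {a : ℝ≥0}
    {f : SpaceTime → E} (h : MemHolderSpace T a f) (ha : 0 < a) : ContinuousOn f (cylinder T) := by
  obtain ⟨C, hC⟩ := h
  exact hC.continuousOn ha

open scoped Classical in
lemma measurable_indicator_of_continuousOn {X : Type*} [TopologicalSpace X] [MeasurableSpace X]
    [BorelSpace X] {s : Set X} {f : X → ℝ} (hf : ContinuousOn f s) (hs : MeasurableSet s) :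
    Measurable (s.indicator f) := by
  rw [← piecewise_eq_indicator]
  exact hf.measurable_piecewise continuousOn_const hs

/-- The extension of `ρ` by zero to all of space-time. -/
noncomputable def extDens (T : ℝ) (ρ : SpaceTime → ℝ) : SpaceTime → ℝ := (cylinder T).indicator ρ

/-- The components of the extension of `u` by zero to all of space-time. -/
noncomputable def extVel (T : ℝ) (u : SpaceTime → Vel) (i : Fin 3) : SpaceTime → ℝ :=
  (cylinder T).indicator fun z => u z i

lemma exists_holderState {T : ℝ} {α β : ℝ≥0} {ρ : SpaceTime → ℝ} {u : SpaceTime → Vel}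
    (hα : 0 < α) (hβ : 0 < β) (hρ_nonneg : ∀ z ∈ cylinder T, 0 ≤ ρ z)
    (hρ : MemHolderSpace T α ρ) (hρu : MemHolderSpace T α fun z => ρ z • u z)
    (hu : MemHolderSpace T β u) :
    ∃ C, HolderState T α β C (extDens T ρ) (extVel T u) := by
  obtain ⟨A, hA1, hA2⟩ := hρ.exists_bound
  obtain ⟨B, hB1, hB2⟩ := hρu.exists_bound
  obtain ⟨D, hD1, hD2⟩ := hu.exists_bound
  set C := 1 + |A| + |B| + |D| with hC
  have hA : A ≤ C := by linarith [le_abs_self A, abs_nonneg B, abs_nonneg D]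
  have hB : B ≤ C := by linarith [le_abs_self B, abs_nonneg A, abs_nonneg D]
  have hD : D ≤ C := by linarith [le_abs_self D, abs_nonneg B, abs_nonneg A]
  have hC1 : 1 ≤ C := by linarith [abs_nonneg B, abs_nonneg A, abs_nonneg D]
  refine ⟨C, hC1, fun z => indicator_apply_nonneg fun hz => hρ_nonneg z hz,
    measurable_indicator_of_continuousOn (hρ.continuousOn hα) (measurableSet_cylinder T),
    fun i => measurable_indicator_of_continuousOn ?_ (measurableSet_cylinder T),
    fun z => ?_, fun i z => ?_, fun k x hx y hy => ?_, fun i x hx y hy => ?_⟩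
  · exact (EuclideanSpace.proj i).continuous.comp_continuousOn (hu.continuousOn hβ)
  · by_cases hz : z ∈ cylinder T
    · simpa [extDens, hz] using ((le_abs_self _).trans (hA2 z hz)).trans hA
    · simpa [extDens, hz] using zero_le_one.trans hC1
  · by_cases hz : z ∈ cylinder T
    · simpa [extVel, hz] using ((PiLp.norm_apply_le (u z) i).trans (hD2 z hz)).trans hD
    · simpa [extVel, hz] using zero_le_one.trans hC1
  · cases k with
    | none =>
      simpa [extDens, fourVel, hx, hy] using (hA1 x hx y hy).trans
        (mul_le_mul_of_nonneg_right hA (Real.rpow_nonneg dist_nonneg _))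
    | some i =>
      have := ((PiLp.norm_apply_le _ i).trans (hB1 x hx y hy)).trans
        (mul_le_mul_of_nonneg_right hB (Real.rpow_nonneg dist_nonneg _))
      simpa [extDens, extVel, fourVel, hx, hy] using this
  · have := ((PiLp.norm_apply_le _ i).trans (hD1 x hx y hy)).trans
      (mul_le_mul_of_nonneg_right hD (Real.rpow_nonneg dist_nonneg _))
    simpa [extVel, hx, hy] using this

lemma IsConservationLaw.sum_integral_eq_zero {T : ℝ} {e : SpaceTime → ℝ} {F : SpaceTime → Vel}
    (h : IsConservationLaw T e F) {G : Option (Fin 3) → SpaceTime → ℝ} (hG : ∀ k, BddMeas (G k))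
    (h0 : ∀ z ∈ cylinder T, G none z = e z)
    (hj : ∀ j, ∀ z ∈ cylinder T, G (some j) z = F z j)
    {ψ : SpaceTime → ℝ} (hψ : IsTestFunction T ψ) :
    ∑ k, ∫ z, G k z * dirDeriv (axis k) ψ z = 0 := by
  have hint : ∀ k, Integrable fun z => G k z * dirDeriv (axis k) ψ z := fun k => by
    have := (hG k).integrable_mul (by
      simpa using hψ.isSmooth.integrable_mul_dirDeriv (f := fun _ => 1) continuous_const
        hψ.hasCompactSupport (axis k))
    simpa only [mul_comm] using this
  rw [← integral_finsetSum _ fun k _ => hint k,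
    ← setIntegral_eq_integral_of_forall_compl_eq_zero (s := cylinder T) fun z hz => ?_,
    ← h.weak_eq ψ hψ]
  · refine setIntegral_congr_fun (measurableSet_cylinder T) fun z hz => ?_
    simp only [Fintype.sum_option, dirDeriv_axis_none, dirDeriv_axis_some, h0 z hz, hj _ z hz]
  · have hz' : z ∉ tsupport ψ := fun h' => hz (hψ.tsupport_subset h')
    simp [dirDeriv_eq_zero hz']

lemma pressurePotential_rpow {γ x : ℝ} (hγ : 1 < γ) (hx : 0 ≤ x) :
    pressurePotential (fun s => s ^ γ) x = x ^ γ / (γ - 1) - x / (γ - 1) := by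
  rcases hx.eq_or_lt with rfl | hx
  · simp [pressurePotential, Real.zero_rpow (by linarith : γ ≠ 0)]
  · have h1 : ∫ s in (1 : ℝ)..x, s ^ γ / s ^ 2 = ∫ s in (1 : ℝ)..x, s ^ (γ - 2) := by
      refine intervalIntegral.integral_congr fun s hs => ?_
      have hs0 : 0 < s := (lt_min one_pos hx).trans_le hs.1
      simp only [Real.rpow_sub hs0, Real.rpow_two]
    have h2 : x ^ γ = x * x ^ (γ - 1) := by
      rw [mul_comm, ← Real.rpow_add_one hx.ne', sub_add_cancel]
    rw [pressurePotential, h1, integral_rpow (Or.inl (by linarith)), h2,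
      show γ - 2 + 1 = γ - 1 by ring, Real.one_rpow]
    ring

section energy

variable {T γ : ℝ} {α β : ℝ≥0} {ρ : SpaceTime → ℝ} {u : SpaceTime → Vel}

lemma continuousOn_energyDensity (hγ : 1 < γ) (hρ_nonneg : ∀ z ∈ cylinder T, 0 ≤ ρ z)
    (hρ : ContinuousOn ρ (cylinder T)) (hu : ContinuousOn u (cylinder T)) :
    ContinuousOn (energyDensity (fun r => r ^ γ) ρ u) (cylinder T) := by
  have h1 : ContinuousOn (fun z => ρ z ^ γ) (cylinder T) :=
    hρ.rpow_const fun _ _ => Or.inr (by linarith)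
  refine ContinuousOn.congr (f := fun z => 1 / 2 * ρ z * ‖u z‖ ^ 2 +
    (ρ z ^ γ / (γ - 1) - ρ z / (γ - 1))) (by fun_prop) fun z hz => ?_
  rw [energyDensity, pressurePotential_rpow hγ (hρ_nonneg z hz)]

lemma continuousOn_energyFlux (hγ : 1 < γ) (hρ_nonneg : ∀ z ∈ cylinder T, 0 ≤ ρ z)
    (hρ : ContinuousOn ρ (cylinder T)) (hu : ContinuousOn u (cylinder T)) :
    ContinuousOn (energyFlux (fun r => r ^ γ) ρ u) (cylinder T) := by
  have h1 : ContinuousOn (fun z => ρ z ^ γ) (cylinder T) :=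
    hρ.rpow_const fun _ _ => Or.inr (by linarith)
  refine ContinuousOn.congr (f := fun z => (1 / 2 * ρ z * ‖u z‖ ^ 2 + ρ z ^ γ +
    (ρ z ^ γ / (γ - 1) - ρ z / (γ - 1))) • u z) (by fun_prop) fun z hz => ?_
  simp only [energyFlux, pressurePotential_rpow hγ (hρ_nonneg z hz)]

/-- The weak form of the energy balance, written as an `energyPairing` minus a multiple of the weak
form of the mass equation. -/
lemma energy_integrand_eq (hγ : 1 < γ) (hρ_nonneg : ∀ z ∈ cylinder T, 0 ≤ ρ z)
    (φ : SpaceTime → ℝ) {z : SpaceTime} (hz : z ∈ cylinder T) :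
    energyDensity (fun r => r ^ γ) ρ u z * timeDeriv φ z +
        ∑ j, energyFlux (fun r => r ^ γ) ρ u z j * spaceDeriv j φ z =
      energyPairing γ (fun k z => extDens T ρ z * fourVel (extVel T u) k z)
        (fourVel (extVel T u)) (extDens T ρ) φ z -
      (γ - 1)⁻¹ * ∑ k, extDens T ρ z * fourVel (extVel T u) k z * dirDeriv (axis k) φ z := by
  simp only [energyPairing, energyDensity, energyFlux, Fintype.sum_option, dirDeriv_axis_none,
    dirDeriv_axis_some, fourVel, extDens, extVel, indicator_of_mem hz,
    pressurePotential_rpow hγ (hρ_nonneg z hz), EuclideanSpace.real_norm_sq_eq, PiLp.smul_apply,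
    smul_eq_mul, Fin.sum_univ_three]
  ring

theorem isConservationLaw_energy (hγ₁ : 1 < γ) (hγ₂ : γ < 2) (hα₀ : 0 < α) (hα₁ : α ≤ 1)
    (hβ₀ : 0 < β) (hγαβ : 1 < γ * (α : ℝ) + (β : ℝ)) (hαβ : 1 < (α : ℝ) + 2 * (β : ℝ))
    (hρ_nonneg : ∀ z ∈ cylinder T, 0 ≤ ρ z) (hρ : MemHolderSpace T α ρ)
    (hρu : MemHolderSpace T α fun z => ρ z • u z) (hu : MemHolderSpace T β u)
    (hsol : IsDistributionalSolution T (fun r => r ^ γ) ρ u) :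
    IsConservationLaw T (energyDensity (fun r => r ^ γ) ρ u)
      (energyFlux (fun r => r ^ γ) ρ u) := by
  have hρc := hρ.continuousOn hα₀
  have huc := hu.continuousOn hβ₀
  refine ⟨(continuousOn_energyDensity hγ₁ hρ_nonneg hρc huc).locallyIntegrableOn
      (measurableSet_cylinder T), (continuousOn_energyFlux hγ₁ hρ_nonneg hρc
      huc).locallyIntegrableOn (measurableSet_cylinder T), fun φ hφ => ?_⟩
  obtain ⟨C, S⟩ := exists_holderState hα₀ hβ₀ hρ_nonneg hρ hρu hu
  have hmass : ∀ ψ, IsTestFunction T ψ → ∑ k, ∫ z, extDens T ρ z *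
      fourVel (extVel T u) k z * dirDeriv (axis k) ψ z = 0 := fun ψ hψ =>
    hsol.mass.sum_integral_eq_zero S.bddMeas_flux
      (fun z hz => by simp [extDens, fourVel, hz])
      (fun j z hz => by simp [extDens, extVel, fourVel, hz]) hψ
  have hmom : ∀ i ψ, IsTestFunction T ψ → ∑ k, ∫ z, momFlux γ (extDens T ρ) (extVel T u) i k z *
      dirDeriv (axis k) ψ z = 0 := fun i ψ hψ =>
    (hsol.momentum i).sum_integral_eq_zero (S.bddMeas_momFlux (by linarith) i)
      (fun z hz => by simp [momFlux, extDens, extVel, fourVel, hz])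
      (fun j z hz => by
        by_cases hij : j = i
        · simp [momFlux, extDens, extVel, fourVel, hz, hij]
        · simp [momFlux, extDens, extVel, fourVel, hz, hij]
          ring) hψ
  have hpair := S.integral_energyPairing_eq_zero (by exact_mod_cast hα₀) (by exact_mod_cast hα₁)
    (by exact_mod_cast hβ₀) hγ₁ hγ₂ hγαβ hαβ hmass hmom hφ
  obtain ⟨Φ, -, hdΦ⟩ := hφ.exists_bound
  have hD : ∀ k, Integrable (dirDeriv (axis k) φ) := fun k => by
    simpa using hφ.isSmooth.integrable_mul_dirDeriv (f := fun _ => 1) continuous_const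
      hφ.hasCompactSupport (axis k)
  have i1 : ∀ k, Integrable fun z => extDens T ρ z * fourVel (extVel T u) k z *
      dirDeriv (axis k) φ z := fun k => by
    simpa only [mul_comm] using (S.bddMeas_flux k).integrable_mul (hD k)
  have i2 : Integrable (energyPairing γ (fun k z => extDens T ρ z * fourVel (extVel T u) k z)
      (fourVel (extVel T u)) (extDens T ρ) φ) := by
    have m1 : Measurable (extDens T ρ) := S.measurable_dens
    have m2 : ∀ k, Measurable (fourVel (extVel T u) k) := fun k => (S.bddMeas_fourVel k).measurable
    have m3 : ∀ k, Measurable (dirDeriv (axis k) φ) := fun k =>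
      (hφ.isSmooth.continuous_dirDeriv _).measurable
    have hm : Measurable (energyPairing γ (fun k z => extDens T ρ z * fourVel (extVel T u) k z)
        (fourVel (extVel T u)) (extDens T ρ) φ) := by
      unfold energyPairing
      fun_prop
    rw [← integrableOn_iff_integrable_of_support_subset (s := tsupport φ) fun z hz =>
      by_contra fun h => hz (energyPairing_eq_zero h)]
    have hCC : C ≤ C ^ 2 := by nlinarith [S.one_le]
    refine Measure.integrableOn_of_bounded hφ.hasCompactSupport.isCompact.measure_lt_top.ne
      hm.aestronglyMeasurable (Filter.Eventually.of_forall fun z =>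
        abs_energyPairing_le (C := C ^ 2) (Φ := Φ) hγ₁ (sq_nonneg C) (fun k => ?_)
          (fun k => (S.fourVel_le k z).trans hCC) (S.nonneg z) ((S.dens_le z).trans hCC)
          (fun k => hdΦ k z))
    rw [abs_mul, abs_of_nonneg (S.nonneg z), sq]
    exact mul_le_mul (S.dens_le z) (S.fourVel_le k z) (abs_nonneg _)
      (zero_le_one.trans S.one_le)
  rw [setIntegral_congr_fun (measurableSet_cylinder T) fun z hz =>
      energy_integrand_eq hγ₁ hρ_nonneg φ hz,
    setIntegral_eq_integral_of_forall_compl_eq_zero fun z hz => ?_,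
    integral_sub i2 ((integrable_finsetSum _ fun k _ => i1 k).const_mul _), integral_const_mul,
    integral_finsetSum _ fun k _ => i1 k, hmass φ hφ, hpair]
  · simp
  · have hz' : z ∉ tsupport φ := fun h' => hz (hφ.tsupport_subset h')
    simp [energyPairing_eq_zero hz', dirDeriv_eq_zero hz']

end energy

/-! ### Global energy conservation -/

section global

open scoped Convolution

variable {T : ℝ} {e : SpaceTime → ℝ} {F : SpaceTime → Vel}

lemma isTestFunction_comp_snd {χ : ℝ → ℝ} (hχ : ContDiff ℝ ∞ χ) (hc : HasCompactSupport χ)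
    (hs : tsupport χ ⊆ Ioo 0 T) : IsTestFunction T fun z => χ z.2 := by
  have h1 : tsupport (fun z : SpaceTime => χ z.2) ⊆ univ ×ˢ tsupport χ :=
    closure_minimal (fun z hz => ⟨mem_univ _, subset_tsupport χ hz⟩)
      (isClosed_univ.prod (isClosed_tsupport χ))
  exact ⟨hχ.comp contDiff_snd, (isCompact_univ.prod hc.isCompact).of_isClosed_subset
    (isClosed_tsupport _) h1, h1.trans (prod_mono Subset.rfl hs)⟩

lemma continuousOn_integral_slice {C : ℝ} (he : ContinuousOn e (cylinder T))
    (hC : ∀ z ∈ cylinder T, |e z| ≤ C) :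
    ContinuousOn (fun t => ∫ x, e (x, t)) (Ioo 0 T) := by
  refine continuousOn_of_dominated (bound := fun _ => C) (fun t ht => ?_) (fun t ht => ?_)
    (integrable_const C) (Filter.Eventually.of_forall fun x => ?_)
  · have : Continuous fun x => e (x, t) :=
      he.comp_continuous (by fun_prop) fun x => ⟨mem_univ _, ht⟩
    exact this.aestronglyMeasurable
  · exact Filter.Eventually.of_forall fun x => hC _ ⟨mem_univ _, ht⟩
  · exact he.comp (by fun_prop) fun t ht => ⟨mem_univ _, ht⟩

lemma IsConservationLaw.integral_deriv_mul_eq_zero {C : ℝ} (h : IsConservationLaw T e F)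
    (he : ContinuousOn e (cylinder T)) (hC : ∀ z ∈ cylinder T, |e z| ≤ C) {χ : ℝ → ℝ}
    (hχ : ContDiff ℝ ∞ χ) (hc : HasCompactSupport χ) (hs : tsupport χ ⊆ Ioo 0 T) :
    ∫ t in Ioo 0 T, deriv χ t * ∫ x, e (x, t) = 0 := by
  have hcd : Continuous (deriv χ) := hχ.continuous_deriv (by simp)
  have h1 := h.weak_eq _ (isTestFunction_comp_snd hχ hc hs)
  have h2 : ∀ z : SpaceTime, timeDeriv (fun z => χ z.2) z = deriv χ z.2 := fun z => rfl
  have h3 : ∀ j (z : SpaceTime), spaceDeriv j (fun z => χ z.2) z = 0 := fun j z => by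
    simp [spaceDeriv]
  simp only [h2, h3, mul_zero, Finset.sum_const_zero, add_zero] at h1
  have hμ : (volume : Measure SpaceTime).restrict (cylinder T) =
      (volume : Measure (UnitAddTorus (Fin 3))).prod (volume.restrict (Ioo 0 T)) := by
    rw [cylinder, Measure.volume_eq_prod, ← Measure.prod_restrict, Measure.restrict_univ]
  obtain ⟨D, hD⟩ := hcd.bounded_above_of_compact_support hc.deriv
  have hint : Integrable (fun z : SpaceTime => e z * deriv χ z.2)
      ((volume : Measure (UnitAddTorus (Fin 3))).prod (volume.restrict (Ioo 0 T))) := by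
    rw [← hμ]
    refine (integrableOn_const (C := C * D) (isBounded_cylinder T).measure_lt_top.ne).mono'
      ((he.mul (hcd.comp continuous_snd).continuousOn).aestronglyMeasurable
        (measurableSet_cylinder T))
      ((ae_restrict_mem (measurableSet_cylinder T)).mono fun z hz => ?_)
    rw [norm_mul]
    exact mul_le_mul (hC z hz) (hD _) (norm_nonneg _) ((abs_nonneg _).trans (hC z hz))
  rw [hμ, integral_prod_symm _ hint] at h1
  refine Eq.trans ?_ h1
  refine integral_congr_ae (Filter.Eventually.of_forall fun t => ?_)
  simp only
  rw [integral_mul_const, mul_comm]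

/-- For a conservation law with a continuous bounded density, the integral of the density over the
torus is constant in time: its mollifications in time have zero derivative. -/
theorem IsConservationLaw.integral_slice_eq {C : ℝ} (h : IsConservationLaw T e F)
    (he : ContinuousOn e (cylinder T)) (hC : ∀ z ∈ cylinder T, |e z| ≤ C)
    {s t : ℝ} (hs : s ∈ Ioo 0 T) (ht : t ∈ Ioo 0 T) : ∫ x, e (x, s) = ∫ x, e (x, t) := by
  set J : ℝ → ℝ := (Ioo 0 T).indicator fun t => ∫ x, e (x, t) with hJ
  have hcont := continuousOn_integral_slice he hC
  have hJm : Measurable J := measurable_indicator_of_continuousOn hcont measurableSet_Ioo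
  have hJC : ∀ t, ‖J t‖ ≤ |C| * (volume : Measure (UnitAddTorus (Fin 3))).real univ := by
    intro t
    by_cases ht : t ∈ Ioo 0 T
    · simp only [hJ, indicator_of_mem ht]
      exact norm_integral_le_of_norm_le_const (Filter.Eventually.of_forall fun x =>
        (hC (x, t) ⟨mem_univ _, ht⟩).trans (le_abs_self C))
    · rw [hJ, indicator_of_notMem ht, norm_zero]
      positivity
  have hJloc : LocallyIntegrable J := (locallyIntegrable_const
    (|C| * (volume : Measure (UnitAddTorus (Fin 3))).real univ)).mono hJm.aestronglyMeasurable
    (Filter.Eventually.of_forall fun t => (hJC t).trans (le_abs_self _))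
  let b : ℕ → ContDiffBump (0 : ℝ) := fun n =>
    ⟨1 / (n + 1 : ℝ) / 2, 1 / (n + 1 : ℝ), by positivity, by
      have : 0 < 1 / (n + 1 : ℝ) := by positivity
      linarith⟩
  have hb0 : Filter.Tendsto (fun n => (b n).rOut) Filter.atTop (nhds 0) :=
    tendsto_one_div_add_atTop_nhds_zero_nat
  have hlim : ∀ τ ∈ Ioo 0 T, Filter.Tendsto (fun n => ((b n).normed volume
      ⋆[ContinuousLinearMap.lsmul ℝ ℝ, volume] J) τ) Filter.atTop (nhds (∫ x, e (x, τ))) := by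
    intro τ hτ
    have hJτ : Filter.Tendsto J (nhds τ) (nhds (∫ x, e (x, τ))) := by
      refine (hcont.continuousAt (isOpen_Ioo.mem_nhds hτ)).tendsto.congr' ?_
      filter_upwards [isOpen_Ioo.mem_nhds hτ] with r hr
      simp [hJ, indicator_of_mem hr]
    exact ContDiffBump.convolution_tendsto_right hb0
      (Filter.Eventually.of_forall fun _ => hJm.aestronglyMeasurable)
      (hJτ.comp Filter.tendsto_snd) tendsto_const_nhds
  refine tendsto_nhds_unique ((hlim s hs).congr' ?_) (hlim t ht)
  have hsm : ∀ᶠ n in Filter.atTop, (b n).rOut < min (min s (T - s)) (min t (T - t)) :=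
    hb0.eventually (gt_mem_nhds (lt_min (lt_min hs.1 (sub_pos.2 hs.2))
      (lt_min ht.1 (sub_pos.2 ht.2))))
  filter_upwards [hsm] with n hn
  simp only [lt_min_iff] at hn
  set η := (b n).normed (volume : Measure ℝ) with hη
  have hηs : ContDiff ℝ ∞ η := (b n).contDiff_normed
  have hηc : HasCompactSupport η := (b n).hasCompactSupport_normed
  have hder : ∀ τ, HasDerivAt (η ⋆[ContinuousLinearMap.lsmul ℝ ℝ, volume] J)
      ((deriv η ⋆[ContinuousLinearMap.lsmul ℝ ℝ, volume] J) τ) τ := fun τ =>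
    hηc.hasDerivAt_convolution_left _ (hηs.of_le (by simp)) hJloc τ
  have hzero : ∀ τ ∈ Ioo (b n).rOut (T - (b n).rOut),
      (deriv η ⋆[ContinuousLinearMap.lsmul ℝ ℝ, volume] J) τ = 0 := by
    intro τ hτ
    have hd : ∀ r, deriv (fun r => η (τ - r)) r = -deriv η (τ - r) := fun r =>
      deriv_comp_const_sub η τ r
    have hsub : tsupport (fun r => η (τ - r)) ⊆ Ioo 0 T := by
      have h1 : tsupport (fun r => η (τ - r)) = (Homeomorph.subLeft τ) ⁻¹' tsupport η :=
        tsupport_comp_eq_preimage η (Homeomorph.subLeft τ)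
      rw [h1, hη, ContDiffBump.tsupport_normed_eq]
      intro r hr
      have h2 : |τ - r| ≤ (b n).rOut := by simpa using hr
      have h3 := abs_le.1 h2
      exact ⟨by linarith [h3.2, hτ.1], by linarith [h3.1, hτ.2]⟩
    have h4 := h.integral_deriv_mul_eq_zero he hC (χ := fun r => η (τ - r))
      (hηs.comp (contDiff_const.sub contDiff_id)) (hηc.comp_homeomorph (Homeomorph.subLeft τ)) hsub
    rw [convolution_lsmul_swap, ← neg_eq_zero, ← integral_neg, ← h4,
      ← integral_indicator measurableSet_Ioo]
    refine integral_congr_ae (Filter.Eventually.of_forall fun r => ?_)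
    by_cases hr : r ∈ Ioo 0 T
    · simp only [hJ, indicator_of_mem hr, hd, smul_eq_mul, neg_mul]
    · simp only [hJ, indicator_of_notMem hr, smul_zero, neg_zero]
  refine isOpen_Ioo.is_const_of_deriv_eq_zero isPreconnected_Ioo
    (fun τ _ => (hder τ).differentiableAt.differentiableWithinAt)
    (fun τ hτ => (hder τ).deriv.trans (hzero τ hτ)) ⟨hn.1.1, ?_⟩ ⟨hn.2.1, ?_⟩
  · linarith [hn.1.2]
  · linarith [hn.2.2]

lemma exists_energyDensity_bound {γ : ℝ} {α β : ℝ≥0} {ρ : SpaceTime → ℝ} {u : SpaceTime → Vel}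
    (hγ : 1 < γ) (hρ_nonneg : ∀ z ∈ cylinder T, 0 ≤ ρ z) (hρ : MemHolderSpace T α ρ)
    (hu : MemHolderSpace T β u) :
    ∃ C, ∀ z ∈ cylinder T, |energyDensity (fun r => r ^ γ) ρ u z| ≤ C := by
  obtain ⟨A, -, hA⟩ := hρ.exists_bound
  obtain ⟨B, -, hB⟩ := hu.exists_bound
  have hγ' : 0 < γ - 1 := sub_pos.2 hγ
  refine ⟨1 / 2 * A * B ^ 2 + (A ^ γ / (γ - 1) + A / (γ - 1)), fun z hz => ?_⟩
  have h0 := hρ_nonneg z hz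
  have h1 : ρ z ≤ A := (le_abs_self _).trans (hA z hz)
  have h2 : 0 ≤ A := h0.trans h1
  rw [energyDensity, pressurePotential_rpow hγ h0]
  refine (abs_add_le _ _).trans (add_le_add ?_ ((abs_sub _ _).trans (add_le_add ?_ ?_)))
  · rw [abs_of_nonneg (by positivity)]
    gcongr
    exact hB z hz
  · rw [abs_of_nonneg (by positivity)]
    gcongr
  · rw [abs_of_nonneg (by positivity)]
    gcongr

end global

end CompressibleEuler

theorem theorem7p1 (T γ : ℝ) (α β : ℝ≥0) (hT : 0 < T)
    (hγ₁ : 1 < γ) (hγ₂ : γ < 2)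
    (hα₀ : 0 < α) (hα₁ : α ≤ 1) (hβ₀ : 0 < β) (hβ₁ : β ≤ 1)
    (hγαβ : 1 < γ * (α : ℝ) + (β : ℝ)) (hαβ : 1 < (α : ℝ) + 2 * (β : ℝ))
    (ρ : CompressibleEuler.SpaceTime → ℝ)
    (u : CompressibleEuler.SpaceTime → CompressibleEuler.Vel)
    (hρ_nonneg : ∀ z ∈ CompressibleEuler.cylinder T, 0 ≤ ρ z)
    (hρ : CompressibleEuler.MemHolderSpace T α ρ)
    (hρu : CompressibleEuler.MemHolderSpace T α fun z => ρ z • u z)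
    (hu : CompressibleEuler.MemHolderSpace T β u)
    (hsol : CompressibleEuler.IsDistributionalSolution T (fun r => r ^ γ) ρ u) :
    CompressibleEuler.IsConservationLaw T
        (CompressibleEuler.energyDensity (fun r => r ^ γ) ρ u)
        (CompressibleEuler.energyFlux (fun r => r ^ γ) ρ u) ∧
      ∀ s ∈ Ioo 0 T, ∀ t ∈ Ioo 0 T,
        ∫ x, CompressibleEuler.energyDensity (fun r => r ^ γ) ρ u (x, s) =
          ∫ x, CompressibleEuler.energyDensity (fun r => r ^ γ) ρ u (x, t) := by
  have hlocal := CompressibleEuler.isConservationLaw_energy hγ₁ hγ₂ hα₀ hα₁ hβ₀ hγαβ hαβ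
    hρ_nonneg hρ hρu hu hsol
  obtain ⟨C, hC⟩ := CompressibleEuler.exists_energyDensity_bound hγ₁ hρ_nonneg hρ hu
  exact ⟨hlocal, fun s hs t ht => hlocal.integral_slice_eq
    (CompressibleEuler.continuousOn_energyDensity hγ₁ hρ_nonneg (hρ.continuousOn hα₀)
      (hu.continuousOn hβ₀)) hC hs ht⟩
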